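/- **Theorem 1.** Consider a semi-Markov decision process with state space $\mathcal S$ and action space $\mathcal A$: if action $a$ is chosen in state $s$ at a decision epoch, then the pair (sojourn time until the next decision epoch, next state) has a probability law depending only on $(s,a)$, with an almost surely positive sojourn time of finite mean $\tau(s,a)$ and transition probabilities $p_{s,a,s'}$; a reward $k(s,a)$ is earned at once and a further reward accrues at rate $c(s,a)$ per unit of time until the next decision epoch, so that the expected reward per epoch is $r(s,a)=k(s,a)+c(s,a)\tau(s,a)$. Let $R(t)$ be the total reward up to time $t$. Fix a stationary policy $\pi$, choosing the action $a_s\in\mathcal A$ in state $s$. Its embedded Markov chain has the transition probabilities $p_{s,a_s,s'}$; a nonempty set $C\subseteq\mathcal S$ is closed if $p_{s,a_s,s'}=0$ for all $s\in C$, $s'\notin C$. An equilibrium distribution is a probability distribution $\omega(\cdot|\pi)$ on $\mathcal S$ with $\omega(s|\pi)=\sum_{s_0}\omega(s_0|\pi)\,p_{s_0,a_{s_0},s}$ for all $s$. (a) Let $\mathcal S$ be finite and nonempty, and suppose that the embedded chain of $\pi$ has no two disjoint closed sets. Then it has exactly one equilibrium distribution $\omega(\cdot|\pi)$, the sum $\sum_s\tau(s,a_s)\omega(s|\pi)$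 is positive, and for every initial state, with probability one, $$\lim_{t\to\infty}\frac{R(t)}{t}=g(\pi):=\frac{\sum_{s\in\mathcal S} r(s,a_s)\,\omega(s|\pi)}{\sum_{s\in\mathcal S}\tau(s,a_s)\,\omega(s|\pi)}.$$ (b) The same holds, with all sums absolutely convergent, for the following network with $K\ge1$ slices, whose state space may be infinite, provided that the embedded chain of $\pi$ has no two disjoint closed sets and that there is a finite set $F\subseteq\mathcal S$ such that from every state the expected number of transitions until the embedded chain next is in $F$ is finite (which is automatic if the chain lives on finitely many states). Slice $k$ has arrival rate $\lambda_k>0$, service rate $\mu_k>0$ and uses the proportions $r_k^X\ge0$ of the three resources $X$ (radio, computing, storage), whose prices per unit of time are $c^X\ge0$; $\delta\ge0$ is a penalty and $n_{\max}\in\mathbb N$. The states are the pairs $s=(n^{\rm req},n^{\rm svc})$ of vectors in $\mathbb N^K$ with $\sum_k r_k^Xn_k^{\rm svc}\le1$ for each $X$; the actions are the vectors $a\in\{0,\dots,n_{\max}\}^K$; $a$ is valid in $s$ if $a_k\le n_k^{\rm req}$ for all $k$ and $\sum_k r_k^X(n_k^{\rm svc}+a_k)\le1$ for each $X$. If $a$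 is chosen in $s$, the next state is $s'$ with probability $p_{s,a,s'}$, where $p$ is any given family of transition probabilities, and, independently of it, the sojourn time is exponential with mean $\tau(s,a)=1/\sum_k(\lambda_k+n_k^{\rm svc}\mu_k+a_k\mu_k)$ if $a$ is valid and $\tau(s,a)=1/\sum_k(\lambda_k+n_k^{\rm svc}\mu_k)$ otherwise. The reward accrues at rate $\sum_k a_k\sum_X r_k^Xc^X$ if $a$ is valid and at rate $-\delta$ otherwise, and $r(s,a)$ is $\tau(s,a)$ times this rate. -/

import Mathlib

open MeasureTheory ProbabilityTheory Filter Topology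
open scoped ENNReal

universe u v w

noncomputable section

/-! ### Semi-Markov decision processes -/

/-- A semi-Markov decision process with state space `S` and action space `A`.  If action `a` is
chosen in state `s` at a decision epoch, then the pair (sojourn time until the next decision epoch,
state at the next decision epoch) has law `law s a`; a reward `lump s a` is earned at once and a
further reward accrues at rate `rate s a` per unit of time until the next decision epoch. -/
structure SMDP (S A : Type*) [MeasurableSpace S] where
  law : S → A → Measure (ℝ × S)
  isProbabilityMeasure_law : ∀ s a, IsProbabilityMeasure (law s a)
  sojourn_pos : ∀ s a, ∀ᵐ x ∂(law s a), 0 < x.1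
  sojourn_integrable : ∀ s a, Integrable (fun x : ℝ × S => x.1) (law s a)
  lump : S → A → ℝ
  rate : S → A → ℝ

namespace SMDP

variable {S A : Type*} [MeasurableSpace S] (M : SMDP S A)

/-- Transition probability `p_{s,a,s'}` of the embedded chain. -/
def trans (s : S) (a : A) (s' : S) : ℝ := (M.law s a).real {x | x.2 = s'}

/-- Mean sojourn time `τ(s,a)`. -/
def meanSojourn (s : S) (a : A) : ℝ := ∫ x, x.1 ∂(M.law s a)

/-- Expected reward `r(s,a)` earned until the next decision epoch. -/
def meanReward (s : S) (a : A) : ℝ := M.lump s a + M.rate s a * M.meanSojourn s a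

/-- A closed set of the embedded chain of the stationary policy `π`: a nonempty set of states that
the chain cannot leave. -/
def IsClosedSet (π : S → A) (C : Set S) : Prop :=
  C.Nonempty ∧ ∀ s ∈ C, ∀ s' ∉ C, M.trans s (π s) s' = 0

/-- The embedded chain of `π` has no two disjoint closed sets. -/
def NoDisjointClosedSets (π : S → A) : Prop :=
  ∀ C D : Set S, M.IsClosedSet π C → M.IsClosedSet π D → ¬ Disjoint C D

/-- `ω` is an equilibrium distribution of the embedded chain of `π`. -/
def IsEquilibrium (π : S → A) (ω : S → ℝ) : Prop :=
  (∀ s, 0 ≤ ω s) ∧ HasSum ω 1 ∧ ∀ s, HasSum (fun s₀ => ω s₀ * M.trans s₀ (π s₀) s) (ω s)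

/-- `M.avoidProb π F n s` is the probability that the embedded chain of `π` started in `s` is
outside `F` at each of the steps `1, …, n`. -/
def avoidProb (π : S → A) (F : Set S) : ℕ → S → ℝ≥0∞
  | 0, _ => 1
  | n + 1, s => ∑' s' : ↥(Fᶜ), ENNReal.ofReal (M.trans s (π s) s') * avoidProb π F n s'

/-- There is a finite set `F` of states such that, from every state, the expected number of steps
until the embedded chain of `π` next is in `F` is finite
(the expectation is the sum over `n` of the probability that this takes more than `n` steps). -/
def ReturnsToFiniteSet (π : S → A) : Prop :=
  ∃ F : Set S, F.Finite ∧ ∀ s, ∑' n, M.avoidProb π F n s < ∞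

/-- `X 0, X 1, …` (successive states) and `T 0, T 1, …` (successive sojourn times), defined on a
probability space `(Ω, P)`, form a run of the decision process under the stationary policy `π` from
the initial state `s₀`: given the past up to a decision epoch in state `s`, the next sojourn time
and the next state have the joint law `M.law s (π s)`. -/
structure IsRun (π : S → A) (s₀ : S) {Ω : Type*} [MeasurableSpace Ω] (P : Measure Ω)
    (X : ℕ → Ω → S) (T : ℕ → Ω → ℝ) : Prop where
  measurable_state : ∀ n, Measurable (X n)
  measurable_sojourn : ∀ n, Measurable (T n)
  initial : ∀ᵐ z ∂P, X 0 z = s₀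
  finite_dim : ∀ (n : ℕ) (x : ℕ → S) (B : ℕ → Set ℝ), x 0 = s₀ → (∀ i, MeasurableSet (B i)) →
    P {z | X 0 z = x 0 ∧ ∀ i < n, T i z ∈ B i ∧ X (i + 1) z = x (i + 1)} =
      ∏ i ∈ Finset.range n, M.law (x i) (π (x i)) (B i ×ˢ {x (i + 1)})

/-- The total reward `R(t)` up to time `t`, when `x` is the sequence of states and `d` is the
sequence of sojourn times.  The `n`-th decision epoch is `∑ i < n, d i`; if it is at most `t`, it
contributes its lump reward and the reward accrued at its rate up to the next epoch or up to `t`,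
whichever comes first. -/
def totalReward (π : S → A) (x : ℕ → S) (d : ℕ → ℝ) (t : ℝ) : ℝ :=
  open Classical in
  ∑' n, if ∑ i ∈ Finset.range n, d i ≤ t then
      M.lump (x n) (π (x n))
        + M.rate (x n) (π (x n)) * min (d n) (t - ∑ i ∈ Finset.range n, d i)
    else 0

/-- From every initial state, `R(t) / t → g` with probability one as `t → ∞`. -/
def HasLongRunAverageReward {S : Type u} {A : Type v} [MeasurableSpace S]
    (M : SMDP S A) (π : S → A) (g : ℝ) : Prop :=
  ∀ (s₀ : S) (Ω : Type w) [MeasurableSpace Ω] (P : Measure Ω) [IsProbabilityMeasure P]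
    (X : ℕ → Ω → S) (T : ℕ → Ω → ℝ), M.IsRun π s₀ P X T →
    ∀ᵐ z ∂P, Tendsto (fun t : ℝ => M.totalReward π (fun n => X n z) (fun n => T n z) t / t)
      atTop (𝓝 g)

end SMDP

/-! ### The sliced network with request queues and three kinds of resources -/

/-- Parameters of the network with `K` slices.  The three resources (radio, computing, storage) are
indexed by `Fin 3`. -/
structure SlicedNetwork (K : ℕ) where
  arrivalRate : Fin K → ℝ
  serviceRate : Fin K → ℝ
  usage : Fin K → Fin 3 → ℝ
  price : Fin 3 → ℝ
  penalty : ℝ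
  maxAdmit : ℕ
  slices_pos : 0 < K
  arrivalRate_pos : ∀ k, 0 < arrivalRate k
  serviceRate_pos : ∀ k, 0 < serviceRate k
  usage_nonneg : ∀ k X, 0 ≤ usage k X
  price_nonneg : ∀ X, 0 ≤ price X
  penalty_nonneg : 0 ≤ penalty

namespace SlicedNetwork

variable {K : ℕ} (N : SlicedNetwork K)

/-- States: numbers of waiting requests (`.1`) and of running services (`.2`) in each slice, such
that the running services do not use more than the available resources. -/
def State : Type :=
  {s : (Fin K → ℕ) × (Fin K → ℕ) // ∀ X, ∑ k, N.usage k X * s.2 k ≤ 1}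

instance : Countable N.State := by unfold State; infer_instance

instance : MeasurableSpace N.State := ⊤

/-- Actions: the number of requests to admit in each slice, at most `maxAdmit`. -/
abbrev Action : Type := Fin K → Fin (N.maxAdmit + 1)

/-- Valid actions admit only waiting requests and respect the resource constraints. -/
def Valid (s : N.State) (a : N.Action) : Prop :=
  (∀ k, (a k : ℕ) ≤ s.1.1 k) ∧ ∀ X, ∑ k, N.usage k X * ((s.1.2 k : ℝ) + ((a k : ℕ) : ℝ)) ≤ 1

open Classical in
/-- Rate at which trigger events (arrivals and service completions) occur after action `a` is taken
in state `s`. -/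
def eventRate (s : N.State) (a : N.Action) : ℝ :=
  if N.Valid s a then
    ∑ k, (N.arrivalRate k + s.1.2 k * N.serviceRate k + ((a k : ℕ) : ℝ) * N.serviceRate k)
  else ∑ k, (N.arrivalRate k + s.1.2 k * N.serviceRate k)

/-- The mean sojourn time `τ(s,a)`. -/
def tau (s : N.State) (a : N.Action) : ℝ := 1 / N.eventRate s a

open Classical in
/-- Revenue rate of a valid action; minus the penalty for an invalid one. -/
def revenueRate (s : N.State) (a : N.Action) : ℝ :=
  if N.Valid s a then ∑ k, ((a k : ℕ) : ℝ) * ∑ X, N.usage k X * N.price X else -N.penalty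

/-- The reward `r(s,a)`. -/
def reward (s : N.State) (a : N.Action) : ℝ := N.revenueRate s a * N.tau s a

lemma eventRate_pos (s : N.State) (a : N.Action) : 0 < N.eventRate s a := by
  have : Nonempty (Fin K) := ⟨⟨0, N.slices_pos⟩⟩
  have h := N.arrivalRate_pos
  have h' := N.serviceRate_pos
  unfold eventRate
  split_ifs
  · refine Finset.sum_pos (fun k _ => ?_) Finset.univ_nonempty
    have := h k; have := h' k; positivity
  · refine Finset.sum_pos (fun k _ => ?_) Finset.univ_nonempty
    have := h k; have := h' k; positivity

lemma ae_pos_expMeasure (r : ℝ) : ∀ᵐ x ∂(expMeasure r), 0 < x := by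
  have h : {a : ℝ | ¬ 0 < a} = Set.Iic 0 := by ext; simp
  rw [ae_iff, h, expMeasure, gammaMeasure, withDensity_apply _ measurableSet_Iic,
    Measure.restrict_congr_set Iio_ae_eq_Iic.symm]
  exact lintegral_gammaPDF_of_nonpos le_rfl

lemma integrable_id_expMeasure {r : ℝ} (hr : 0 < r) :
    Integrable (fun x : ℝ => x) (expMeasure r) := by
  have hm : Measurable (gammaPDF 1 r) := (measurable_gammaPDFReal 1 r).ennreal_ofReal
  have h := integrableOn_rpow_mul_exp_neg_mul_rpow (p := 1) (s := 1) (by norm_num) one_pos hr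
  simp only [Real.rpow_one] at h
  rw [expMeasure, gammaMeasure, integrable_withDensity_iff hm (by simp [gammaPDF]),
    ← integrableOn_univ, ← Set.Iio_union_Ici (a := (0 : ℝ)), integrableOn_union]
  constructor
  · refine (integrableOn_zero (μ := volume)).congr_fun (fun x hx => ?_) measurableSet_Iio
    simp [gammaPDF_of_neg hx]
  · rw [integrableOn_Ici_iff_integrableOn_Ioi]
    refine IntegrableOn.congr_fun (Integrable.const_mul h r) (fun x hx => ?_) measurableSet_Ioi
    have hx' : 0 ≤ x := le_of_lt hx
    simp only [gammaPDF_of_nonneg hx']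
    rw [ENNReal.toReal_ofReal (by positivity)]
    simp
    ring

/-- The decision process of the network when `p s a` is the distribution of the next state if action
`a` is chosen in state `s`: the sojourn time is exponential with mean `τ(s,a)` and independent of
the next state, and revenue accrues (or the penalty is paid) continuously in time. -/
def smdp (p : N.State → N.Action → PMF N.State) : SMDP N.State N.Action where
  law s a := (expMeasure (1 / N.tau s a)).prod (p s a).toMeasure
  isProbabilityMeasure_law s a := by
    have := isProbabilityMeasure_expMeasure (r := 1 / N.tau s a)
      (by simpa [tau] using N.eventRate_pos s a)
    infer_instance
  sojourn_pos s a := by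
    have := isProbabilityMeasure_expMeasure (r := 1 / N.tau s a)
      (by simpa [tau] using N.eventRate_pos s a)
    exact Measure.quasiMeasurePreserving_fst.ae (ae_pos_expMeasure _)
  sojourn_integrable s a := by
    have hr : 0 < 1 / N.tau s a := by simpa [tau] using N.eventRate_pos s a
    have := isProbabilityMeasure_expMeasure hr
    exact (integrable_id_expMeasure hr).comp_fst _
  lump _ _ := 0
  rate := N.revenueRate

end SlicedNetwork

end

noncomputable section

namespace SMDP

open scoped Finset

/-! ### Driven runs -/

section Driven

variable {S J : Type*}

/-! The finite-dimensional laws determine the law of a run (`IsRun.map_path_eq`), so an almost sure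
measurable property need only be proved for one convenient construction. The constructions here read
each step from a table of independent entries, at a place chosen from the past and never used twice
(`isRun_driven`). Two different places serve two purposes.

With the place given by the state and the number of earlier visits to it, the steps taken from a
fixed state are i.i.d., and the strong law yields laws of large numbers state by state
(`IsRun.ae_balanced`). With the place given by the current excursion from a finite set and the age
of that excursion, the excursions that start in a given state are i.i.d. Their lengths and durations
have finite mean, because the mean return time is finite and the mean sojourn times are bounded.
Hence steps from states outside a large finite set contribute little to the averages of both the
number of steps and the elapsed time (`IsRun.ae_tight`).

The rest is deterministic, along one such trajectory. The vectors of visit frequencies lie in the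
compact space `[0,1]^S`. By tightness and the laws of large numbers every cluster point is an
equilibrium distribution (`Regular.isEquilibrium`), which gives existence. Two different equilibrium
distributions would produce two disjoint closed sets, namely where the one or the other is larger
(`IsEquilibrium.unique`). So the frequencies converge, tightness carries this over to the averages
of rewards and of sojourn times (`Regular.tendsto_average`), and dividing the two gives the reward
per unit of time (`tendsto_totalReward_div`). For finitely many states the whole space serves as the
finite set; for the network, rewards and mean sojourn times are bounded uniformly in the state. -/

/-- A rule choosing an index from a trajectory looks only at the past. -/
def Nonanticipating (sel : ℕ → (ℕ → S) → J) : Prop :=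
  ∀ n x x', (∀ i ≤ n, x i = x' i) → sel n x = sel n x'

/-- The trajectory up to time `n` (continued as a constant) when the step taken at time `n` from
state `s` is read off the table `y` at the entry `(sel n history, s)`. -/
def drivenHistory (sel : ℕ → (ℕ → S) → J) (s₀ : S) (y : J × S → ℝ × S) : ℕ → ℕ → S
  | 0 => fun _ => s₀
  | n + 1 => Function.update (drivenHistory sel s₀ y n) (n + 1)
      (y (sel n (drivenHistory sel s₀ y n), drivenHistory sel s₀ y n n)).2

/-- The state at time `n` of the process driven by the table `y`. -/
def drivenState (sel : ℕ → (ℕ → S) → J) (s₀ : S) (y : J × S → ℝ × S) (n : ℕ) : S :=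
  drivenHistory sel s₀ y n n

/-- The sojourn time at time `n` of the process driven by the table `y`. -/
def drivenSojourn (sel : ℕ → (ℕ → S) → J) (s₀ : S) (y : J × S → ℝ × S) (n : ℕ) : ℝ :=
  (y (sel n (drivenState sel s₀ y), drivenState sel s₀ y n)).1

variable {sel : ℕ → (ℕ → S) → J} {s₀ : S} {y : J × S → ℝ × S}

@[simp] lemma drivenState_zero : drivenState sel s₀ y 0 = s₀ := rfl

lemma drivenHistory_eq {n i : ℕ} (h : i ≤ n) :
    drivenHistory sel s₀ y n i = drivenState sel s₀ y i := by
  induction n with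
  | zero => obtain rfl : i = 0 := by omega
            rfl
  | succ n ih =>
    rcases h.eq_or_lt with rfl | h
    · rfl
    · rw [drivenHistory, Function.update_of_ne (by omega), ih (by omega)]

lemma drivenState_succ (hsel : Nonanticipating sel) (n : ℕ) :
    drivenState sel s₀ y (n + 1) =
      (y (sel n (drivenState sel s₀ y), drivenState sel s₀ y n)).2 := by
  rw [drivenState, drivenHistory, Function.update_self,
    hsel n _ (drivenState sel s₀ y) (fun i hi => drivenHistory_eq hi), drivenHistory_eq le_rfl]

/-- A finite word as a trajectory. -/
def extendWord {n : ℕ} (w : Fin (n + 1) → S) : ℕ → S := fun i => w ⟨min i n, by omega⟩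

lemma extendWord_of_le {n i : ℕ} (w : Fin (n + 1) → S) (h : i ≤ n) :
    extendWord w i = w ⟨i, by omega⟩ := by
  simp [extendWord, h]

variable [Countable S] [MeasurableSpace S] [DiscreteMeasurableSpace S]
  [MeasurableSpace J]

/-- The choice at time `n` factors through the first `n + 1` states, and these range over a
countable discrete space. -/
lemma Nonanticipating.measurable (hsel : Nonanticipating sel) (n : ℕ) : Measurable (sel n) := by
  have h : sel n = (fun w : Fin (n + 1) → S => sel n (extendWord w)) ∘ fun x i => x i := by
    funext x
    exact hsel n _ _ fun i hi => by simp [extendWord, hi]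
  rw [h]
  exact (measurable_of_countable _).comp (by fun_prop)

variable [Countable J] [DiscreteMeasurableSpace J]
  {Ω : Type*} [MeasurableSpace Ω] {Y : J × S → Ω → ℝ × S}

lemma measurable_table {q : Ω → J × S} (hY : ∀ j, Measurable (Y j)) (hq : Measurable q) :
    Measurable fun z => Y (q z) z := by
  have h : Measurable fun p : (J × S) × Ω => Y p.1 p.2 := measurable_from_prod_countable_right hY
  exact h.comp (hq.prodMk measurable_id)

lemma measurable_drivenHistory (hsel : Nonanticipating sel) (hY : ∀ j, Measurable (Y j)) (n : ℕ) :
    Measurable fun z => drivenHistory sel s₀ (fun q => Y q z) n := by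
  induction n with
  | zero => exact measurable_const
  | succ n ih =>
    refine measurable_pi_lambda _ fun i => ?_
    by_cases hi : i = n + 1
    · subst hi
      simp only [drivenHistory, Function.update_self]
      exact (measurable_table (q := fun z => (sel n (drivenHistory sel s₀ (fun q => Y q z) n),
        drivenHistory sel s₀ (fun q => Y q z) n n)) hY
        (((hsel.measurable n).comp ih).prodMk ((measurable_pi_apply n).comp ih))).snd
    · simp only [drivenHistory, Function.update_of_ne hi]
      exact (measurable_pi_apply i).comp ih

lemma measurable_drivenState (hsel : Nonanticipating sel) (hY : ∀ j, Measurable (Y j)) (n : ℕ) :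
    Measurable fun z => drivenState sel s₀ (fun q => Y q z) n :=
  (measurable_pi_apply n).comp (measurable_drivenHistory hsel hY n)

lemma measurable_drivenSojourn (hsel : Nonanticipating sel) (hY : ∀ j, Measurable (Y j)) (n : ℕ) :
    Measurable fun z => drivenSojourn sel s₀ (fun q => Y q z) n := by
  have h : Measurable fun z => drivenState sel s₀ (fun q => Y q z) :=
    measurable_pi_lambda _ (measurable_drivenState hsel hY)
  exact (measurable_table (q := fun z => (sel n (drivenState sel s₀ (fun q => Y q z)),
    drivenState sel s₀ (fun q => Y q z) n)) hY
    (((hsel.measurable n).comp h).prodMk (measurable_drivenState hsel hY n))).fst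

variable {A : Type*} {M : SMDP S A} {π : S → A} {P : Measure Ω}

/-- A process driven by a table of independent steps that never reads an entry twice is a run. -/
lemma isRun_driven [IsProbabilityMeasure P] (hsel : Nonanticipating sel)
    (hinj : ∀ x : ℕ → S, x 0 = s₀ → Function.Injective fun n => (sel n x, x n))
    (hY : ∀ j, Measurable (Y j)) (hindep : iIndepFun Y P)
    (hlaw : ∀ j s, P.map (Y (j, s)) = M.law s (π s)) :
    M.IsRun π s₀ P (fun n z => drivenState sel s₀ (fun q => Y q z) n)
      (fun n z => drivenSojourn sel s₀ (fun q => Y q z) n) where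
  measurable_state := measurable_drivenState hsel hY
  measurable_sojourn := measurable_drivenSojourn hsel hY
  initial := by simp
  finite_dim n x B hx hB := by
    -- As long as the trajectory agrees with `x`, the places read are the deterministic ones along
    -- `x`, so the event only concerns fixed entries of the table. They are distinct by `hinj`,
    -- hence independent.
    have hset : {z | drivenState sel s₀ (fun q => Y q z) 0 = x 0 ∧ ∀ i < n,
        drivenSojourn sel s₀ (fun q => Y q z) i ∈ B i ∧
        drivenState sel s₀ (fun q => Y q z) (i + 1) = x (i + 1)} =
        ⋂ i ∈ Finset.range n, Y (sel i x, x i) ⁻¹' (B i ×ˢ {x (i + 1)}) := by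
      ext z
      simp only [Set.mem_ofPred_eq, drivenState_zero, Set.mem_iInter, Finset.mem_range,
        Set.mem_preimage, Set.mem_prod, Set.mem_singleton_iff]
      have key : ∀ i, (∀ j ≤ i, drivenState sel s₀ (fun q => Y q z) j = x j) →
          drivenSojourn sel s₀ (fun q => Y q z) i = (Y (sel i x, x i) z).1 ∧
          drivenState sel s₀ (fun q => Y q z) (i + 1) = (Y (sel i x, x i) z).2 := by
        intro i hi
        rw [drivenState_succ hsel, drivenSojourn, hsel i _ x hi, hi i le_rfl]
        exact ⟨rfl, rfl⟩
      constructor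
      · rintro ⟨-, h⟩ i hi
        have := key i fun j hj => by
          rcases j with _ | j
          · simp [hx]
          · exact (h j (by omega)).2
        rw [← this.1, ← this.2]
        exact h i hi
      · intro h
        have hs : ∀ j ≤ n, drivenState sel s₀ (fun q => Y q z) j = x j := by
          intro j
          induction j using Nat.strong_induction_on with
          | _ j ih =>
            rcases j with _ | j
            · simp [hx]
            · intro hj
              rw [(key j fun i hi => ih i (by omega) (by omega)).2, (h j hj).2]
        refine ⟨hx.symm, fun i hi => ?_⟩
        rw [(key i fun j hj => hs j (by omega)).1]
        exact ⟨(h i hi).1, hs _ hi⟩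
    have hmeas : ∀ i, MeasurableSet (B i ×ˢ ({x (i + 1)} : Set S)) := fun i =>
      (hB i).prod (measurableSet_singleton _)
    rw [hset, (hindep.precomp (hinj x hx)).measure_inter_preimage_eq_mul (S := Finset.range n)
      (sets := fun i => B i ×ˢ {x (i + 1)}) (fun i _ => hmeas i)]
    refine Finset.prod_congr rfl fun i _ => ?_
    rw [← hlaw (sel i x) (x i), Measure.map_apply (hY _) (hmeas i)]

end Driven

/-! ### Uniqueness of the law of a run, and the Markov property -/

section Law

variable {S A : Type*} [MeasurableSpace S]
  {M : SMDP S A} {π : S → A} {s₀ : S} {Ω : Type*} [MeasurableSpace Ω] {P : Measure Ω}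
  {X : ℕ → Ω → S} {T : ℕ → Ω → ℝ}

/-- The trajectory of pairs (sojourn time, state). -/
def path (X : ℕ → Ω → S) (T : ℕ → Ω → ℝ) (z : Ω) : ℕ → ℝ × S := fun n => (T n z, X n z)

lemma IsRun.measurable_path (h : M.IsRun π s₀ P X T) : Measurable (path X T) :=
  measurable_pi_lambda _ fun n => (h.measurable_sojourn n).prodMk (h.measurable_state n)

/-- The word of the states visited up to time `n`. -/
def word (X : ℕ → Ω → S) (n : ℕ) (z : Ω) : Fin (n + 1) → S := fun i => X i z

lemma IsRun.measurable_word (h : M.IsRun π s₀ P X T) (n : ℕ) : Measurable (word X n) :=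
  measurable_pi_lambda _ fun i => h.measurable_state i

/-- Complements `finite_dim`, which only speaks of words that begin with the initial state. -/
lemma IsRun.measure_word_eq_zero (h : M.IsRun π s₀ P X T) {n : ℕ} {w : Fin (n + 1) → S}
    (hw : w 0 ≠ s₀) (E : Set Ω) : P (word X n ⁻¹' {w} ∩ E) = 0 := by
  refine measure_mono_null ?_ (ae_iff.1 h.initial)
  rintro z ⟨hz, -⟩
  rw [Set.mem_preimage, Set.mem_singleton_iff] at hz
  rw [Set.mem_ofPred_eq, ← show word X n z 0 = X 0 z from rfl, hz]
  exact hw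

lemma IsRun.measure_word (h : M.IsRun π s₀ P X T) {n : ℕ} {w : Fin (n + 1) → S}
    (hw : w 0 = s₀) {B : ℕ → Set ℝ} (hB : ∀ i, MeasurableSet (B i)) :
    P (word X n ⁻¹' {w} ∩ {z | ∀ i < n, T i z ∈ B i}) =
      ∏ i ∈ Finset.range n, M.law (extendWord w i) (π (extendWord w i))
        (B i ×ˢ {extendWord w (i + 1)}) := by
  rw [← h.finite_dim n (extendWord w) B (by simpa [extendWord] using hw) hB]
  congr 1
  ext z
  simp only [Set.mem_inter_iff, Set.mem_preimage, Set.mem_singleton_iff, Set.mem_ofPred_eq]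
  constructor
  · rintro ⟨rfl, hz⟩
    refine ⟨by simp [extendWord, word], fun i hi => ⟨hz i hi, ?_⟩⟩
    rw [extendWord_of_le _ (by omega)]
    rfl
  · rintro ⟨h0, hz⟩
    refine ⟨?_, fun i hi => (hz i hi).1⟩
    funext ⟨i, hi⟩
    rcases i with _ | i
    · rw [extendWord_of_le _ (by omega)] at h0
      exact h0
    · have := (hz i (by omega)).2
      rw [extendWord_of_le _ (by omega)] at this
      exact this

lemma measure_inter_preimage_eq_tsum {W : Type*} [MeasurableSpace W] [DiscreteMeasurableSpace W]
    [Countable W] {f : Ω → W} (hf : Measurable f) (D : Set W) (E : Set Ω) :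
    P (f ⁻¹' D ∩ E) = ∑' w : D, P (f ⁻¹' {(w : W)} ∩ E) := by
  rw [← Measure.restrict_apply (hf (.of_discrete)), ← tsum_measure_preimage_singleton
    D.to_countable (fun w _ => hf (.of_discrete))]
  exact tsum_congr fun w => Measure.restrict_apply (hf .of_discrete)

variable [DiscreteMeasurableSpace S] [Countable S]

/-- Once the word of states is fixed, a condition on a pair (sojourn time, state) becomes a
condition on the sojourn time alone, and `finite_dim` gives the probability of such an event. -/
lemma IsRun.measure_path_pi (h : M.IsRun π s₀ P X T) {s : Finset ℕ} {n : ℕ} (hn : ∀ i ∈ s, i < n)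
    (t : ℕ → Set (ℝ × S)) : P (path X T ⁻¹' (s : Set ℕ).pi t) =
      ∑' w : (Set.univ : Set (Fin (n + 1) → S)), P (word X n ⁻¹' {(w : Fin (n + 1) → S)} ∩
        {z | ∀ i < n, T i z ∈ if i ∈ s then {r | (r, extendWord (w : Fin (n + 1) → S) i) ∈ t i}
          else Set.univ}) := by
  rw [← Set.univ_inter (path X T ⁻¹' _), ← Set.preimage_univ (f := word X n),
    measure_inter_preimage_eq_tsum (h.measurable_word n)]
  refine tsum_congr fun w => ?_
  congr 1
  ext z
  simp only [Set.mem_inter_iff, Set.mem_preimage, Set.mem_singleton_iff, Set.mem_ofPred_eq,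
    Set.mem_pi, SetLike.mem_coe, path]
  refine and_congr_right fun hz => ?_
  have hx : ∀ i < n, extendWord (w : Fin (n + 1) → S) i = X i z := fun i hi => by
    rw [← hz, extendWord_of_le _ hi.le]; rfl
  constructor
  · intro H i hi
    split_ifs with his
    · simpa [hx i hi] using H i his
    · trivial
  · intro H i his
    have := H i (hn i his)
    simpa [his, hx i (hn i his)] using this

/-- Two runs from the same initial state have the same law. -/
lemma IsRun.map_path_eq {Ω' : Type*} [MeasurableSpace Ω'] {P' : Measure Ω'}
    [IsProbabilityMeasure P] [IsProbabilityMeasure P'] {X' : ℕ → Ω' → S} {T' : ℕ → Ω' → ℝ}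
    (h : M.IsRun π s₀ P X T) (h' : M.IsRun π s₀ P' X' T') :
    P.map (path X T) = P'.map (path X' T') := by
  have := Measure.isProbabilityMeasure_map (μ := P) h.measurable_path.aemeasurable
  have := Measure.isProbabilityMeasure_map (μ := P') h'.measurable_path.aemeasurable
  -- The cylinders with measurable sides form a π-system that generates the product σ-algebra.
  refine ext_of_generate_finite (squareCylinders fun _ => {t | MeasurableSet t})
    generateFrom_squareCylinders.symm
    (isPiSystem_squareCylinders (fun _ => MeasurableSpace.isPiSystem_measurableSet) (by simp))
    ?_ (by simp)
  rintro _ ⟨s, t, ht, rfl⟩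
  have ht' : ∀ i, MeasurableSet (t i) := fun i => ht i (Set.mem_univ i)
  have hm : MeasurableSet ((s : Set ℕ).pi t) := .pi s.countable_toSet fun i _ => ht' i
  rw [Measure.map_apply h.measurable_path hm, Measure.map_apply h'.measurable_path hm]
  obtain ⟨n, hn⟩ : ∃ n, ∀ i ∈ s, i < n :=
    ⟨s.sup id + 1, fun i hi => Nat.lt_succ_of_le (Finset.le_sup (f := id) hi)⟩
  rw [h.measure_path_pi hn, h'.measure_path_pi hn]
  refine tsum_congr fun w => ?_
  by_cases hw : (w : Fin (n + 1) → S) 0 = s₀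
  · have hB : ∀ i, MeasurableSet (if i ∈ s then
        {r : ℝ | (r, extendWord (w : Fin (n + 1) → S) i) ∈ t i} else Set.univ) := by
      intro i
      split_ifs
      · exact measurable_prodMk_right (ht' i)
      · exact .univ
    rw [h.measure_word hw hB, h'.measure_word hw hB]
  · rw [h.measure_word_eq_zero hw, h'.measure_word_eq_zero hw]

/-- Almost sure measurable path properties carry over from one run to any other. -/
lemma IsRun.ae_path_of_ae_path {Ω' : Type*} [MeasurableSpace Ω'] {P' : Measure Ω'}
    [IsProbabilityMeasure P] [IsProbabilityMeasure P'] {X' : ℕ → Ω' → S} {T' : ℕ → Ω' → ℝ}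
    (h : M.IsRun π s₀ P X T) (h' : M.IsRun π s₀ P' X' T') {Q : (ℕ → ℝ × S) → Prop}
    (hQ : MeasurableSet {y | Q y}) (hP : ∀ᵐ z ∂P, Q (path X T z)) :
    ∀ᵐ z ∂P', Q (path X' T' z) := by
  refine ae_of_ae_map h'.measurable_path.aemeasurable ?_
  rw [← h.map_path_eq h']
  exact (ae_map_iff h.measurable_path.aemeasurable hQ).2 hP

/-- Given a past ending in `u`, the next (sojourn time, state) has the law prescribed at `u`. -/
lemma IsRun.map_restrict_word (h : M.IsRun π s₀ P X T) [IsFiniteMeasure P] {n : ℕ} {u : S}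
    {D : Set (Fin (n + 1) → S)} (hD : ∀ w ∈ D, w (Fin.last n) = u) :
    (P.restrict (word X n ⁻¹' D)).map (fun z => (T n z, X (n + 1) z)) =
      P (word X n ⁻¹' D) • M.law u (π u) := by
  have hm : Measurable fun z => (T n z, X (n + 1) z) :=
    (h.measurable_sojourn n).prodMk (h.measurable_state (n + 1))
  -- Since `S` is countable, every measurable set of pairs is a disjoint union of slices `B ×ˢ {s}`,
  -- so these boxes suffice.
  have hbox : ∀ (B : Set ℝ), MeasurableSet B → ∀ s : S,
      P (word X n ⁻¹' D ∩ {z | T n z ∈ B ∧ X (n + 1) z = s}) =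
        P (word X n ⁻¹' D) * M.law u (π u) (B ×ˢ {s}) := by
    intro B hB s
    rw [measure_inter_preimage_eq_tsum (h.measurable_word n), ← Set.inter_univ (word X n ⁻¹' D),
      measure_inter_preimage_eq_tsum (h.measurable_word n), ← ENNReal.tsum_mul_right]
    refine tsum_congr fun ⟨w, hw⟩ => ?_
    by_cases h0 : w 0 = s₀
    -- The past word prolonged by the next state `s`. Comparing `finite_dim` for `n + 1` and for `n`
    -- leaves just the last factor, which is the law at `u`.
    · set x : ℕ → S := Function.update (extendWord w) (n + 1) s with hx
      have hxi : ∀ (i) (hi : i ≤ n), x i = w ⟨i, by omega⟩ := fun i hi => by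
        rw [hx, Function.update_of_ne (by omega), extendWord_of_le w hi]
      have hx1 : x (n + 1) = s := by rw [hx, Function.update_self]
      have hx0 : x 0 = s₀ := by rw [hxi 0 (by omega)]; exact h0
      have e1 := h.finite_dim (n + 1) x (fun i => if i = n then B else Set.univ) hx0
        (by intro i; split_ifs <;> simp [hB])
      have e2 := h.finite_dim n x (fun i => Set.univ) hx0 (by simp)
      rw [Finset.prod_range_succ] at e1
      have e3 : ∏ i ∈ Finset.range n, M.law (x i) (π (x i))
          ((if i = n then B else Set.univ) ×ˢ {x (i + 1)}) =
          ∏ i ∈ Finset.range n, M.law (x i) (π (x i)) (Set.univ ×ˢ {x (i + 1)}) := by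
        refine Finset.prod_congr rfl fun i hi => ?_
        rw [if_neg (Finset.mem_range.1 hi).ne]
      have hxn : x n = u := by rw [hxi n le_rfl]; exact hD w hw
      rw [e3, ← e2, if_pos rfl, hx1, hxn] at e1
      have hword : ∀ z, word X n z = w ↔ X 0 z = x 0 ∧ ∀ i < n, X (i + 1) z = x (i + 1) := by
        intro z
        constructor
        · intro hz
          have : ∀ i ≤ n, X i z = x i := fun i hi => by rw [hxi i hi, ← hz]; rfl
          exact ⟨this 0 (by omega), fun i hi => this _ hi⟩
        · rintro ⟨hz0, hz⟩
          funext ⟨i, hi⟩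
          rw [← hxi i (by omega)]
          rcases i with _ | i
          · exact hz0
          · exact hz i (by omega)
      convert e1 using 2
      · ext z
        simp only [Set.mem_inter_iff, Set.mem_preimage, Set.mem_singleton_iff, Set.mem_ofPred_eq,
          hword]
        constructor
        · rintro ⟨⟨a, b⟩, c, d⟩
          refine ⟨a, fun i hi => ?_⟩
          rcases (Nat.lt_succ_iff.1 hi).eq_or_lt with rfl | hi'
          · simp [c, d, hx1]
          · simp [hi'.ne, b i hi']
        · rintro ⟨a, b⟩
          refine ⟨⟨a, fun i hi => (b i (by omega)).2⟩, ?_, ?_⟩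
          · simpa using (b n (by omega)).1
          · rw [(b n (by omega)).2, hx1]
      · congr 1
        ext z
        simp [hword]
    · rw [h.measure_word_eq_zero h0, h.measure_word_eq_zero h0, zero_mul]
  ext E hE
  have hsplit : E = ⋃ s : S, {r | (r, s) ∈ E} ×ˢ {s} := by
    ext ⟨r, s⟩
    simp
  have hEs : ∀ s : S, MeasurableSet {r : ℝ | (r, s) ∈ E} := fun s => measurable_prodMk_right hE
  have hmeas : ∀ s : S, MeasurableSet ({r : ℝ | (r, s) ∈ E} ×ˢ ({s} : Set S)) := fun s =>
    (hEs s).prod (measurableSet_singleton s)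
  have hdisj : Pairwise (Function.onFun Disjoint
      fun s : S => ({r : ℝ | (r, s) ∈ E} ×ˢ ({s} : Set S))) := by
    intro s s' hne
    rw [Function.onFun, Set.disjoint_left]
    rintro ⟨r, t⟩ ⟨-, h1⟩ ⟨-, h2⟩
    exact hne (by simp at h1 h2; rw [← h1, ← h2])
  rw [hsplit, measure_iUnion hdisj hmeas, measure_iUnion hdisj hmeas]
  refine tsum_congr fun s => ?_
  rw [Measure.map_apply hm (hmeas s), Measure.restrict_apply (hm (hmeas s)), Set.inter_comm,
    Measure.smul_apply, smul_eq_mul, ← hbox _ (hEs s)]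
  rfl

end Law

/-! ### Laws of large numbers at single states -/

section Balance

variable {S A : Type*}

/-- Used with `c n` the number of visits to a state, which may stay bounded: the hypothesis gives
`|a k| ≤ C + ε / 2 * k` for all `k`, so convergence of `c` to infinity is not needed. -/
lemma tendsto_div_of_le {a : ℕ → ℝ} (ha : Tendsto (fun n : ℕ => a n / n) atTop (𝓝 0)) {c : ℕ → ℕ}
    (hc : ∀ n, c n ≤ n) : Tendsto (fun n : ℕ => a (c n) / n) atTop (𝓝 0) := by
  rw [Metric.tendsto_atTop] at ha ⊢
  intro ε hε
  obtain ⟨N, hN⟩ := ha (ε / 2) (half_pos hε)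
  set C := ∑ i ∈ Finset.range (N + 1), |a i| with hC
  have hbound : ∀ n, |a n| ≤ C + ε / 2 * n := by
    intro n
    have hC0 : 0 ≤ C := Finset.sum_nonneg fun _ _ => abs_nonneg _
    rcases lt_or_ge n (N + 1) with h | h
    · have := Finset.single_le_sum (f := fun i => |a i|) (fun i _ => abs_nonneg _)
        (Finset.mem_range.2 h)
      have h2 : 0 ≤ ε / 2 * n := by positivity
      linarith
    · have h1 := hN n (by omega)
      have hn : (0 : ℝ) < n := by exact_mod_cast (by omega : 0 < n)
      rw [dist_zero_right, Real.norm_eq_abs, abs_div, Nat.abs_cast, div_lt_iff₀ hn] at h1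
      linarith
  obtain ⟨N', hN'⟩ := exists_nat_gt (2 * C / ε)
  refine ⟨N' + 1, fun n hn => ?_⟩
  have hn0 : (0 : ℝ) < n := by exact_mod_cast (by omega : 0 < n)
  have hn1 : (N' : ℝ) < n := by exact_mod_cast (by omega : N' < n)
  rw [dist_zero_right, Real.norm_eq_abs, abs_div, Nat.abs_cast, div_lt_iff₀ hn0]
  have h1 := hbound (c n)
  have h2 : (c n : ℝ) ≤ n := by exact_mod_cast hc n
  have h3 : 2 * C < n * ε := by
    rw [div_lt_iff₀ hε] at hN'
    nlinarith
  nlinarith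

open Classical in
/-- The number of visits to the state `x n` before time `n`. -/
def visitIndex (n : ℕ) (x : ℕ → S) : ℕ := #{j ∈ Finset.range n | x j = x n}

open Classical in
lemma nonanticipating_visitIndex : Nonanticipating (visitIndex (S := S)) := by
  intro n x x' h
  rw [visitIndex, visitIndex]
  congr 1
  refine Finset.filter_congr fun j hj => ?_
  rw [h n le_rfl, h j (Finset.mem_range.1 hj).le]

open Classical in
lemma visitIndex_lt {x : ℕ → S} {m n : ℕ} (h : m < n) (hx : x m = x n) :
    visitIndex m x < visitIndex n x := by
  refine Finset.card_lt_card ⟨fun j hj => ?_, fun hsub => ?_⟩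
  · simp only [Finset.mem_filter, Finset.mem_range] at hj ⊢
    exact ⟨by omega, by rw [hj.2, hx]⟩
  · have : m ∈ Finset.filter (fun j => x j = x m) (Finset.range m) :=
      hsub (Finset.mem_filter.2 ⟨Finset.mem_range.2 h, hx⟩)
    simp at this

/-- Each return to a state raises its visit count; thus no entry of the table is read twice, as
`isRun_driven` demands. -/
lemma injective_visitIndex (x : ℕ → S) : Function.Injective fun n => (visitIndex n x, x n) := by
  intro m n h
  simp only [Prod.mk.injEq] at h
  rcases lt_trichotomy m n with hlt | rfl | hlt
  · exact absurd h.1 (visitIndex_lt hlt h.2).ne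
  · rfl
  · exact absurd h.1 (visitIndex_lt hlt h.2.symm).ne'

-- The visits to `s` are numbered consecutively from `0`, so they use an initial segment of the
-- column of `s`.
open Classical in
lemma sum_visitIndex (x : ℕ → S) (s : S) (a : ℕ → ℝ) (n : ℕ) :
    (∑ i ∈ Finset.range n, if x i = s then a (visitIndex i x) else 0) =
      ∑ k ∈ Finset.range (#{j ∈ Finset.range n | x j = s}), a k := by
  induction n with
  | zero => simp
  | succ n ih =>
    rw [Finset.sum_range_succ, ih, Finset.range_add_one, Finset.filter_insert]
    split_ifs with h
    · rw [Finset.card_insert_of_notMem (by simp), Finset.sum_range_succ, visitIndex, h]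
    · simp

variable [MeasurableSpace S]

open Classical in
/-- Along the trajectory `y`, the averages of `g` (a function of the sojourn time and the next
state) at the visits to `s` agree in the limit with its mean. -/
def Balanced (M : SMDP S A) (π : S → A) (s : S) (g : ℝ × S → ℝ) (y : ℕ → ℝ × S) : Prop :=
  Tendsto (fun n : ℕ => (∑ i ∈ Finset.range n, if (y i).2 = s then
    g ((y i).1, (y (i + 1)).2) - ∫ x, g x ∂M.law s (π s) else 0) / n) atTop (𝓝 0)

variable {M : SMDP S A} {π : S → A} {s₀ : S}

/-- The steps of a table of independent steps, one for each state and each number of visits. -/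
def stepMeasure (M : SMDP S A) (π : S → A) (J : Type*) : Measure (J × S → ℝ × S) :=
  Measure.infinitePi fun q => M.law q.2 (π q.2)

instance (J : Type*) : IsProbabilityMeasure (stepMeasure M π J) := by
  have := M.isProbabilityMeasure_law
  unfold stepMeasure
  infer_instance

lemma iIndepFun_stepMeasure (J : Type*) :
    iIndepFun (fun (q : J × S) (z : J × S → ℝ × S) => z q) (stepMeasure M π J) := by
  have := M.isProbabilityMeasure_law
  exact iIndepFun_infinitePi (X := fun (_ : J × S) (x : ℝ × S) => x) fun _ => measurable_id

lemma stepMeasure_map_eval {J : Type*} (q : J × S) :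
    (stepMeasure M π J).map (fun z => z q) = M.law q.2 (π q.2) := by
  have := M.isProbabilityMeasure_law
  exact Measure.infinitePi_map_eval _ q

/-- The column of `s` in the table is an i.i.d. sequence, to which the strong law applies; the
visits made so far use an initial segment of it, and `tendsto_div_of_le` passes to their random
number. -/
lemma ae_balanced_driven (s : S) {g : ℝ × S → ℝ} (hg : Measurable g)
    (hint : Integrable g (M.law s (π s))) :
    ∀ᵐ z ∂stepMeasure M π ℕ, Balanced M π s g (path (fun n z => drivenState visitIndex s₀ z n)
      (fun n z => drivenSojourn visitIndex s₀ z n) z) := by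
  set m := ∫ x, g x ∂M.law s (π s) with hm
  have hmap : ∀ k : ℕ, (stepMeasure M π ℕ).map (fun z => z (k, s)) = M.law s (π s) :=
    fun k => stepMeasure_map_eval (k, s)
  have hint0 : ∀ k : ℕ, Integrable (fun z => g (z (k, s))) (stepMeasure M π ℕ) := fun k => by
    have h := hint
    rw [← hmap k] at h
    exact h.comp_measurable (measurable_pi_apply _)
  have hlln := strong_law_ae_real (μ := stepMeasure M π ℕ) (fun k z => g (z (k, s))) (hint0 0)
    (fun k l hkl => ((iIndepFun_stepMeasure ℕ).indepFun (i := (k, s)) (j := (l, s))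
      (by simpa using hkl)).comp hg hg)
    (fun k => IdentDistrib.comp ⟨(measurable_pi_apply _).aemeasurable,
      (measurable_pi_apply _).aemeasurable, (hmap k).trans (hmap 0).symm⟩ hg)
  have hmean : ∫ z, g (z (0, s)) ∂stepMeasure M π ℕ = m := by
    rw [hm, ← hmap 0, integral_map (measurable_pi_apply _).aemeasurable
      hg.aestronglyMeasurable]
  filter_upwards [hlln] with z hz
  rw [hmean] at hz
  have h0 : Tendsto (fun n : ℕ => (∑ k ∈ Finset.range n, (g (z (k, s)) - m)) / n) atTop (𝓝 0) := by
    rw [← sub_self m]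
    refine (hz.sub_const m).congr' ?_
    filter_upwards [eventually_gt_atTop 0] with n hn
    have : (n : ℝ) ≠ 0 := by exact_mod_cast hn.ne'
    rw [Finset.sum_sub_distrib, Finset.sum_const, Finset.card_range, nsmul_eq_mul]
    field_simp
  classical
  have h1 := tendsto_div_of_le h0
    (c := fun n => #{j ∈ Finset.range n | drivenState visitIndex s₀ z j = s})
    fun n => (Finset.card_filter_le _ _).trans (by simp)
  refine h1.congr fun n => ?_
  rw [← sum_visitIndex (drivenState visitIndex s₀ z) s (fun k => g (z (k, s)) - m)]
  congr 1
  refine Finset.sum_congr rfl fun i _ => ?_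
  by_cases h : drivenState visitIndex s₀ z i = s
  · refine (if_pos h).trans (Eq.trans ?_ (if_pos h).symm)
    simp only [path, drivenState_succ nonanticipating_visitIndex, drivenSojourn, h, hm]
  · exact (if_neg h).trans (if_neg h).symm

variable [Countable S] [DiscreteMeasurableSpace S]

lemma measurableSet_balanced {s : S} {g : ℝ × S → ℝ} (hg : Measurable g) :
    MeasurableSet {y : ℕ → ℝ × S | Balanced M π s g y} := by
  refine measurableSet_tendsto _ fun n => ?_
  refine (Finset.measurable_sum _ fun i _ => Measurable.ite ?_ ?_ measurable_const).div_const _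
  · exact (measurable_pi_apply i).snd (measurableSet_singleton s)
  · fun_prop

lemma isRun_visitIndex (M : SMDP S A) (π : S → A) (s₀ : S) :
    M.IsRun π s₀ (stepMeasure M π ℕ) (fun n z => drivenState visitIndex s₀ z n)
      (fun n z => drivenSojourn visitIndex s₀ z n) :=
  isRun_driven (Y := fun q (z : ℕ × S → ℝ × S) => z q) nonanticipating_visitIndex
    (fun x _ => injective_visitIndex x) (fun _ => measurable_pi_apply _)
    (iIndepFun_stepMeasure ℕ) fun _ _ => stepMeasure_map_eval _

variable {Ω : Type*} [MeasurableSpace Ω] {P : Measure Ω} [IsProbabilityMeasure P]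
  {X : ℕ → Ω → S} {T : ℕ → Ω → ℝ}

lemma IsRun.ae_balanced (h : M.IsRun π s₀ P X T) (s : S) {g : ℝ × S → ℝ} (hg : Measurable g)
    (hint : Integrable g (M.law s (π s))) : ∀ᵐ z ∂P, Balanced M π s g (path X T z) :=
  (isRun_visitIndex M π s₀).ae_path_of_ae_path h (measurableSet_balanced hg)
    (ae_balanced_driven s hg hint)

lemma IsRun.ae_sojourn_pos (h : M.IsRun π s₀ P X T) : ∀ᵐ z ∂P, ∀ n, 0 < T n z := by
  refine (isRun_visitIndex M π s₀).ae_path_of_ae_path h (Q := fun y => ∀ n, 0 < (y n).1) ?_ ?_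
  · rw [Set.ofPred_forall]
    exact .iInter fun n => measurableSet_lt measurable_const (measurable_pi_apply n).fst
  · have h : ∀ᵐ z ∂stepMeasure M π ℕ, ∀ q : ℕ × S, 0 < (z q).1 := by
      refine ae_all_iff.2 fun q => ?_
      have := M.sojourn_pos q.2 (π q.2)
      rw [← stepMeasure_map_eval q] at this
      exact ae_of_ae_map (measurable_pi_apply q).aemeasurable this
    filter_upwards [h] with z hz n
    exact hz _

end Balance

/-! ### Excursions from a set of states -/

section Excursion

variable {S A Ω : Type*} {X : ℕ → Ω → S}

/-- Outside `F` at the steps `1, …, n`, and in `u` at step `n`. -/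
def avoidEvent (F : Set S) (X : ℕ → Ω → S) (n : ℕ) (u : S) : Set Ω :=
  {z | (∀ i < n, X (i + 1) z ∉ F) ∧ X n z = u}

lemma avoidEvent_eq (F : Set S) (n : ℕ) (u : S) : avoidEvent F X n u =
    word X n ⁻¹' {w | (∀ i (hi : i < n), w ⟨i + 1, by omega⟩ ∉ F) ∧ w (Fin.last n) = u} := rfl

lemma pairwise_disjoint_avoidEvent (F : Set S) (n : ℕ) :
    Pairwise (Function.onFun Disjoint (avoidEvent F X n)) := by
  intro u v huv
  rw [Function.onFun, Set.disjoint_left]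
  rintro z ⟨-, h1⟩ ⟨-, h2⟩
  exact huv (h1.symm.trans h2)

/-- The weight of a step that starts in one of the states numbered `m` and higher. -/
def tailWeight (e : S → ℕ) (m : ℕ) (p : ℝ × S) : ℝ := if m ≤ e p.2 then 1 + |p.1| else 0

lemma tailWeight_nonneg (e : S → ℕ) (m : ℕ) (p : ℝ × S) : 0 ≤ tailWeight e m p := by
  unfold tailWeight; split_ifs <;> positivity

lemma tailWeight_le (e : S → ℕ) (m : ℕ) (p : ℝ × S) : tailWeight e m p ≤ 1 + |p.1| := by
  unfold tailWeight; split_ifs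
  · exact le_rfl
  · positivity

open Classical in
/-- One step of the weight of an excursion. -/
def excursionTerm (e : S → ℕ) (F : Set S) (m : ℕ) (y : ℕ → ℝ × S) (j : ℕ) : ℝ≥0∞ :=
  if ∀ i < j, (y (i + 1)).2 ∉ F then ENNReal.ofReal (tailWeight e m (y j)) else 0

/-- The total weight of the steps before the next visit to `F`. -/
def excursionSum (e : S → ℕ) (F : Set S) (m : ℕ) (y : ℕ → ℝ × S) : ℝ≥0∞ :=
  ∑' j, excursionTerm e F m y j

lemma excursionTerm_le (e : S → ℕ) (F : Set S) (m : ℕ) (y : ℕ → ℝ × S) (j : ℕ) :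
    excursionTerm e F m y j ≤ excursionTerm e F 0 y j := by
  unfold excursionTerm
  split_ifs
  · refine ENNReal.ofReal_le_ofReal ((tailWeight_le e m _).trans ?_)
    simp [tailWeight]
  · exact le_rfl

lemma excursionSum_le (e : S → ℕ) (F : Set S) (m : ℕ) (y : ℕ → ℝ × S) :
    excursionSum e F m y ≤ excursionSum e F 0 y :=
  ENNReal.tsum_le_tsum fun j => excursionTerm_le e F m y j

/-- Dominated convergence for the counting measure on steps: the term of a fixed step vanishes once
`m` exceeds the number of its state. -/
lemma tendsto_excursionSum (e : S → ℕ) (F : Set S) {y : ℕ → ℝ × S}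
    (hy : excursionSum e F 0 y ≠ ∞) :
    Tendsto (fun m => excursionSum e F m y) atTop (𝓝 0) := by
  have h := tendsto_lintegral_of_dominated_convergence (μ := Measure.count)
    (F := fun m j => excursionTerm e F m y j) (f := fun _ => 0) (excursionTerm e F 0 y)
    (fun _ => measurable_of_countable _) (fun m => .of_forall fun j => excursionTerm_le e F m y j)
    (by rwa [lintegral_count]) (.of_forall fun j => ?_)
  · simp only [lintegral_count, tsum_zero] at h
    exact h
  · refine tendsto_const_nhds.congr' ?_
    filter_upwards [eventually_gt_atTop (e (y j).2)] with m hm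
    simp [excursionTerm, tailWeight, hm.not_ge]

variable [MeasurableSpace S]

lemma ofReal_trans (M : SMDP S A) (s : S) (a : A) (s' : S) :
    ENNReal.ofReal (M.trans s a s') = M.law s a {x | x.2 = s'} := by
  have := M.isProbabilityMeasure_law s a
  exact ofReal_measureReal

/-- This permits adding the initial state to the finite set without losing finite mean return times.
-/
lemma avoidProb_anti (M : SMDP S A) (π : S → A) {F F' : Set S} (h : F ⊆ F') (n : ℕ) (s : S) :
    M.avoidProb π F' n s ≤ M.avoidProb π F n s := by
  induction n generalizing s with
  | zero => exact le_rfl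
  | succ n ih =>
    simp only [avoidProb]
    rw [tsum_subtype F'ᶜ fun s' => ENNReal.ofReal (M.trans s (π s) s') * M.avoidProb π F' n s',
      tsum_subtype Fᶜ fun s' => ENNReal.ofReal (M.trans s (π s) s') * M.avoidProb π F n s']
    refine ENNReal.tsum_le_tsum fun s' => ?_
    refine (Set.indicator_le_indicator_of_subset (Set.compl_subset_compl.2 h)
      (fun _ => zero_le) s').trans (Set.indicator_le_indicator ?_)
    gcongr
    exact ih s'

variable {M : SMDP S A} {π : S → A} {s₀ : S} [MeasurableSpace Ω] {P : Measure Ω}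
  {T : ℕ → Ω → ℝ}

lemma lintegral_one_add_abs_sojourn (s : S) (a : A) :
    ∫⁻ x, ENNReal.ofReal (1 + |x.1|) ∂M.law s a = 1 + ENNReal.ofReal (M.meanSojourn s a) := by
  have := M.isProbabilityMeasure_law s a
  have h1 : ∀ x : ℝ × S, ENNReal.ofReal (1 + |x.1|) = 1 + ENNReal.ofReal |x.1| := fun x => by
    rw [ENNReal.ofReal_add zero_le_one (abs_nonneg _), ENNReal.ofReal_one]
  simp_rw [h1]
  rw [lintegral_add_left measurable_const, lintegral_one, measure_univ, meanSojourn,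
    ofReal_integral_eq_lintegral_ofReal (M.sojourn_integrable s a)
      ((M.sojourn_pos s a).mono fun x hx => hx.le)]
  congr 1
  refine lintegral_congr_ae ((M.sojourn_pos s a).mono fun x hx => ?_)
  simp [abs_of_pos hx]

variable [Countable S] [DiscreteMeasurableSpace S]

lemma IsRun.measurableSet_avoidEvent (h : M.IsRun π s₀ P X T) (F : Set S) (n : ℕ) (u : S) :
    MeasurableSet (avoidEvent F X n u) := by
  rw [avoidEvent_eq]
  exact h.measurable_word n .of_discrete

lemma IsRun.map_restrict_avoidEvent (h : M.IsRun π s₀ P X T) [IsFiniteMeasure P] (F : Set S)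
    (n : ℕ) (u : S) :
    (P.restrict (avoidEvent F X n u)).map (fun z => (T n z, X (n + 1) z)) =
      P (avoidEvent F X n u) • M.law u (π u) := by
  rw [avoidEvent_eq]
  exact h.map_restrict_word fun w hw => hw.2

/-- The forward equation of the chain killed on entering `F`, by conditioning on the state at time
`n`. -/
lemma IsRun.measure_avoidEvent_succ (h : M.IsRun π s₀ P X T) [IsFiniteMeasure P] {F : Set S}
    (n : ℕ) {s : S} (hs : s ∉ F) : P (avoidEvent F X (n + 1) s) =
      ∑' u, P (avoidEvent F X n u) * ENNReal.ofReal (M.trans u (π u) s) := by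
  have hm : Measurable fun z => (T n z, X (n + 1) z) :=
    (h.measurable_sojourn n).prodMk (h.measurable_state (n + 1))
  have hE : MeasurableSet {x : ℝ × S | x.2 = s} := measurable_snd (measurableSet_singleton s)
  have hu : avoidEvent F X (n + 1) s = ⋃ u, avoidEvent F X n u ∩ {z | X (n + 1) z = s} := by
    ext z
    simp only [avoidEvent, Set.mem_ofPred_eq, Set.mem_iUnion, Set.mem_inter_iff]
    constructor
    · rintro ⟨h1, h2⟩
      exact ⟨X n z, ⟨fun i hi => h1 i (by omega), rfl⟩, h2⟩
    · rintro ⟨u, ⟨h1, -⟩, h2⟩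
      refine ⟨fun i hi => ?_, h2⟩
      rcases (Nat.lt_succ_iff.1 hi).eq_or_lt with rfl | hi
      · rwa [h2]
      · exact h1 i hi
  rw [hu, measure_iUnion]
  · refine tsum_congr fun u => ?_
    rw [ofReal_trans, ← smul_eq_mul, ← Measure.smul_apply, ← h.map_restrict_avoidEvent F n u,
      Measure.map_apply hm hE, Measure.restrict_apply (hm hE), Set.inter_comm]
    rfl
  · exact fun u v huv => (pairwise_disjoint_avoidEvent F n huv).mono Set.inter_subset_left
      Set.inter_subset_left
  · exact fun u => (h.measurableSet_avoidEvent F n u).inter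
      (h.measurable_state (n + 1) (measurableSet_singleton s))

/-- The events grow by a last step, whereas `avoidProb` is defined by conditioning on the first
step. Letting `m` further steps follow reconciles the two: the induction moves one step at a time
from `m` to `n`. -/
lemma IsRun.tsum_measure_avoidEvent_mul (h : M.IsRun π s₀ P X T) [IsProbabilityMeasure P]
    (F : Set S) (n m : ℕ) :
    ∑' u, P (avoidEvent F X n u) * M.avoidProb π F m u = M.avoidProb π F (n + m) s₀ := by
  induction n generalizing m with
  | zero =>
    have h0 : ∀ u, avoidEvent F X 0 u = {z | X 0 z = u} := fun u => by simp [avoidEvent]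
    have hne : ∀ u, u ≠ s₀ → P {z | X 0 z = u} = 0 := fun u hu =>
      measure_mono_null (fun z (hz : X 0 z = u) (h : X 0 z = s₀) => hu (hz.symm.trans h))
        (ae_iff.1 h.initial)
    have heq : P {z | X 0 z = s₀} = 1 := by
      rw [← measure_univ (μ := P)]
      exact measure_congr (eventuallyEq_univ.2 h.initial)
    rw [tsum_eq_single s₀ fun u hu => by rw [h0, hne u hu, zero_mul], h0, heq, one_mul, zero_add]
  | succ n ih =>
    have hsupp : (Function.support fun u =>
        P (avoidEvent F X (n + 1) u) * M.avoidProb π F m u) ⊆ Fᶜ := by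
      intro u hu huF
      refine hu ?_
      have : avoidEvent F X (n + 1) u = ∅ :=
        Set.eq_empty_of_forall_notMem fun z ⟨h1, h2⟩ => h1 n (by omega) (h2 ▸ huF)
      simp [this]
    rw [← tsum_subtype_eq_of_support_subset hsupp, Nat.add_right_comm, add_assoc, ← ih (m + 1)]
    calc ∑' s : ↥(Fᶜ), P (avoidEvent F X (n + 1) s) * M.avoidProb π F m s
        = ∑' s : ↥(Fᶜ), ∑' u, P (avoidEvent F X n u) * (ENNReal.ofReal (M.trans u (π u) s) *
            M.avoidProb π F m s) := by
          refine tsum_congr fun s => ?_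
          rw [h.measure_avoidEvent_succ n s.2, ← ENNReal.tsum_mul_right]
          exact tsum_congr fun u => mul_assoc _ _ _
      _ = _ := by
          rw [ENNReal.tsum_comm]
          refine tsum_congr fun u => ?_
          rw [ENNReal.tsum_mul_left]
          rfl

lemma measurable_tailWeight (e : S → ℕ) (m : ℕ) : Measurable (tailWeight e m) := by
  have he : Measurable e := measurable_of_countable e
  exact Measurable.ite (measurableSet_le measurable_const (he.comp measurable_snd))
    (by fun_prop) measurable_const

lemma measurable_excursionTerm (e : S → ℕ) (F : Set S) (m j : ℕ) :
    Measurable fun y => excursionTerm e F m y j := by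
  refine Measurable.ite ?_ ((measurable_tailWeight e m).comp (measurable_pi_apply j)).ennreal_ofReal
    measurable_const
  simp only [Set.ofPred_forall]
  exact .iInter fun i => .iInter fun _ =>
    (measurable_snd.comp (measurable_pi_apply (i + 1))) (MeasurableSet.of_discrete (s := Fᶜ))

lemma measurable_excursionSum (e : S → ℕ) (F : Set S) (m : ℕ) :
    Measurable (excursionSum e F m) :=
  Measurable.tsum fun j => measurable_excursionTerm e F m j

/-- Whether the excursion is still running at step `j` is decided by the states up to time `j`, and
given these the sojourn time has mean at most `C`. -/
lemma IsRun.lintegral_excursionTerm_le (h : M.IsRun π s₀ P X T) [IsProbabilityMeasure P]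
    {C : ℝ} (hC : ∀ s, M.meanSojourn s (π s) ≤ C) (e : S → ℕ) (F : Set S) (j : ℕ) :
    ∫⁻ z, excursionTerm e F 0 (path X T z) j ∂P ≤
      (1 + ENNReal.ofReal C) * M.avoidProb π F j s₀ := by
  have hm : Measurable fun z => (T j z, X (j + 1) z) :=
    (h.measurable_sojourn j).prodMk (h.measurable_state (j + 1))
  have hw : Measurable fun x : ℝ × S => ENNReal.ofReal (1 + |x.1|) := by fun_prop
  have hterm : ∀ z, excursionTerm e F 0 (path X T z) j =
      (⋃ u, avoidEvent F X j u).indicator (fun z => ENNReal.ofReal (1 + |T j z|)) z := by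
    intro z
    have hiff : z ∈ ⋃ u, avoidEvent F X j u ↔ ∀ i < j, (path X T z (i + 1)).2 ∉ F := by
      simp [avoidEvent, path]
    by_cases hz : z ∈ ⋃ u, avoidEvent F X j u
    · rw [Set.indicator_of_mem hz, excursionTerm, if_pos (hiff.1 hz)]
      simp [tailWeight, path]
    · rw [Set.indicator_of_notMem hz, excursionTerm, if_neg (mt hiff.2 hz)]
  simp_rw [hterm]
  rw [lintegral_indicator (.iUnion fun u => h.measurableSet_avoidEvent F j u),
    lintegral_iUnion (h.measurableSet_avoidEvent F j) (pairwise_disjoint_avoidEvent F j)]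
  calc ∑' u, ∫⁻ z in avoidEvent F X j u, ENNReal.ofReal (1 + |T j z|) ∂P
      = ∑' u, P (avoidEvent F X j u) * (1 + ENNReal.ofReal (M.meanSojourn u (π u))) := by
        refine tsum_congr fun u => ?_
        rw [← lintegral_one_add_abs_sojourn, ← smul_eq_mul, ← lintegral_smul_measure,
          ← h.map_restrict_avoidEvent F j u, lintegral_map hw hm]
    _ ≤ ∑' u, P (avoidEvent F X j u) * (1 + ENNReal.ofReal C) := by
        refine ENNReal.tsum_le_tsum fun u => ?_
        gcongr
        exact hC u
    _ = (1 + ENNReal.ofReal C) * M.avoidProb π F j s₀ := by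
        rw [ENNReal.tsum_mul_right, mul_comm]
        congr 1
        simpa [avoidProb] using h.tsum_measure_avoidEvent_mul F j 0

lemma IsRun.lintegral_excursionSum_lt_top (h : M.IsRun π s₀ P X T) [IsProbabilityMeasure P]
    {C : ℝ} (hC : ∀ s, M.meanSojourn s (π s) ≤ C) (e : S → ℕ) {F : Set S}
    (hF : ∑' n, M.avoidProb π F n s₀ < ∞) :
    ∫⁻ z, excursionSum e F 0 (path X T z) ∂P < ∞ := by
  unfold excursionSum
  have hmeas : ∀ j, Measurable fun z => excursionTerm e F 0 (path X T z) j := fun j =>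
    (measurable_excursionTerm e F 0 j).comp h.measurable_path
  rw [lintegral_tsum fun j => (hmeas j).aemeasurable]
  refine (ENNReal.tsum_le_tsum fun j => h.lintegral_excursionTerm_le hC e F j).trans_lt ?_
  rw [ENNReal.tsum_mul_left]
  exact ENNReal.mul_lt_top (by simp) hF

/-- Dominated convergence, with the integrable total weight `excursionSum e F 0` as majorant. -/
lemma IsRun.tendsto_lintegral_excursionSum (h : M.IsRun π s₀ P X T) [IsProbabilityMeasure P]
    {C : ℝ} (hC : ∀ s, M.meanSojourn s (π s) ≤ C) (e : S → ℕ) {F : Set S}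
    (hF : ∑' n, M.avoidProb π F n s₀ < ∞) :
    Tendsto (fun m => ∫⁻ z, excursionSum e F m (path X T z) ∂P) atTop (𝓝 0) := by
  have hfin := h.lintegral_excursionSum_lt_top hC e hF
  have hmeas : ∀ m, Measurable fun z => excursionSum e F m (path X T z) := fun m =>
    (measurable_excursionSum e F m).comp h.measurable_path
  have := tendsto_lintegral_of_dominated_convergence (μ := P)
    (F := fun m z => excursionSum e F m (path X T z)) (f := fun _ => 0)
    (fun z => excursionSum e F 0 (path X T z)) hmeas
    (fun m => .of_forall fun z => excursionSum_le e F m _) hfin.ne ?_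
  · simpa using this
  · filter_upwards [ae_lt_top (hmeas 0) hfin.ne] with z hz
    exact tendsto_excursionSum e F hz.ne

end Excursion

/-! ### Tightness of the visits -/

section Tightness

variable {S : Type*}

open Classical in
/-- The last time up to `n` at which the trajectory `x` is in `F` (`0` if there is none). -/
def lastVisit (F : Set S) (n : ℕ) (x : ℕ → S) : ℕ := Nat.findGreatest (fun i => x i ∈ F) n

open Classical in
lemma lastVisit_le (F : Set S) (n : ℕ) (x : ℕ → S) : lastVisit F n x ≤ n :=
  Nat.findGreatest_le n

lemma lastVisit_mem {F : Set S} {x : ℕ → S} (h : x 0 ∈ F) (n : ℕ) : x (lastVisit F n x) ∈ F := by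
  classical
  exact Nat.findGreatest_spec (P := fun i => x i ∈ F) (Nat.zero_le n) h

lemma notMem_of_lastVisit_lt {F : Set S} {x : ℕ → S} {n i : ℕ} (h : lastVisit F n x < i)
    (hi : i ≤ n) : x i ∉ F := by
  classical
  exact Nat.findGreatest_is_greatest h hi

lemma lastVisit_eq_of_mem_Icc {F : Set S} {x : ℕ → S} (h : x 0 ∈ F) {n m : ℕ}
    (h1 : lastVisit F n x ≤ m) (h2 : m ≤ n) : lastVisit F m x = lastVisit F n x := by
  classical
  rw [lastVisit, Nat.findGreatest_eq_iff]
  exact ⟨h1, fun _ => lastVisit_mem h n, fun i hi hi' => notMem_of_lastVisit_lt hi (hi'.trans h2)⟩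

lemma lastVisit_congr (F : Set S) {n : ℕ} {x x' : ℕ → S} (h : ∀ i ≤ n, x i = x' i) :
    lastVisit F n x = lastVisit F n x' := by
  classical
  have key : lastVisit F n x = Nat.findGreatest (fun i => x i ∈ F) n := by
    unfold lastVisit; congr
  rw [key, Nat.findGreatest_eq_iff]
  refine ⟨lastVisit_le F n x', fun h0 => ?_, fun i hi hi' => ?_⟩
  · rw [h _ (lastVisit_le F n x')]
    exact Nat.findGreatest_of_ne_zero (P := fun i => x' i ∈ F) rfl h0
  · rw [h i hi']
    exact notMem_of_lastVisit_lt hi hi'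

/-- The label of the step at time `n`: the state in which the current excursion from `F` started,
the number of earlier visits to that state, and the age of the excursion. -/
def excursionIndex (F : Set S) (n : ℕ) (x : ℕ → S) : (S × ℕ) × ℕ :=
  ((x (lastVisit F n x), visitIndex (lastVisit F n x) x), n - lastVisit F n x)

lemma nonanticipating_excursionIndex (F : Set S) : Nonanticipating (excursionIndex F) := by
  intro n x x' h
  have hl := lastVisit_le F n x'
  rw [excursionIndex, excursionIndex, lastVisit_congr F h, h _ hl,
    nonanticipating_visitIndex _ x x' fun i hi => h i (hi.trans hl)]

/-- The starting state and its visit count determine when the excursion began, and the age then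
determines the time. -/
lemma injective_excursionIndex (F : Set S) (x : ℕ → S) :
    Function.Injective fun n => excursionIndex F n x := by
  intro m n h
  simp only [excursionIndex, Prod.mk.injEq] at h
  have h1 : lastVisit F m x = lastVisit F n x :=
    injective_visitIndex x (Prod.ext h.1.2 h.1.1)
  have := lastVisit_le F m x
  have := lastVisit_le F n x
  omega

/-- The process started in `f` that uses the table `b` once at each time. -/
def blockPath (f : S) (b : ℕ × S → ℝ × S) : ℕ → ℝ × S :=
  path (fun n b => drivenState (fun n _ => n) f b n) (fun n b => drivenSojourn (fun n _ => n) f b n)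
    b

lemma nonanticipating_clock : Nonanticipating fun n (_ : ℕ → S) => n := fun _ _ _ _ => rfl

/-- The table of the steps of all excursions. -/
def blockTable (q : ((S × ℕ) × ℕ) × S) (z : S × ℕ → ℕ × S → ℝ × S) : ℝ × S :=
  z q.1.1 (q.1.2, q.2)

variable {F : Set S} {s₀ : S}

/-- The process driven by the table of the steps of all excursions. -/
def blockDriven (F : Set S) (s₀ : S) (z : S × ℕ → ℕ × S → ℝ × S) : ℕ → ℝ × S :=
  path (fun n z => drivenState (excursionIndex F) s₀ (fun q => blockTable q z) n)
    (fun n z => drivenSojourn (excursionIndex F) s₀ (fun q => blockTable q z) n) z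

/-- During one excursion all steps are read from the same block `z (f, k)`, at the places given by
the age. So the process follows `blockPath` for that block until the excursion ends. -/
lemma excursionTerm_blockPath (hs₀ : s₀ ∈ F) (e : S → ℕ) (m n : ℕ)
    (z : S × ℕ → ℕ × S → ℝ × S) :
    ENNReal.ofReal (tailWeight e m (blockDriven F s₀ z n)) =
      excursionTerm e F m
        (blockPath (excursionIndex F n fun i => (blockDriven F s₀ z i).2).1.1
          (z (excursionIndex F n fun i => (blockDriven F s₀ z i).2).1))
        (excursionIndex F n fun i => (blockDriven F s₀ z i).2).2 := by
  set x : ℕ → S := fun i => (blockDriven F s₀ z i).2 with hx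
  have hx0 : x 0 ∈ F := hs₀
  set l := lastVisit F n x with hl
  have hln : l ≤ n := lastVisit_le F n x
  set b := z (x l, visitIndex l x) with hb
  have hstep : ∀ j, l + j ≤ n → excursionIndex F (l + j) x = ((x l, visitIndex l x), j) := by
    intro j hj
    have : lastVisit F (l + j) x = l := lastVisit_eq_of_mem_Icc hx0 (by omega) hj
    rw [excursionIndex, this]
    simp
  have hstate : ∀ j, l + j ≤ n → (blockPath (x l) b j).2 = x (l + j) := by
    intro j
    induction j with
    | zero => intro _; rfl
    | succ j ih =>
      intro hj
      have h1 := ih (by omega)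
      have h2 : x (l + j + 1) = (blockTable (excursionIndex F (l + j) x, x (l + j)) z).2 :=
        drivenState_succ (nonanticipating_excursionIndex F) (l + j)
      rw [← add_assoc, h2, hstep j (by omega), ← h1]
      exact drivenState_succ nonanticipating_clock j
  have hlast : blockPath (x l) b (n - l) = blockDriven F s₀ z n := by
    have h1 : l + (n - l) = n := by omega
    refine Prod.ext ?_ ((hstate (n - l) h1.le).trans (by rw [h1]))
    have h2 : (blockDriven F s₀ z n).1 = (blockTable (excursionIndex F n x, x n) z).1 := rfl
    have h3 := hstep (n - l) h1.le
    have h4 := hstate (n - l) h1.le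
    rw [h1] at h3 h4
    rw [h2, h3, ← h4]
    rfl
  have hterm : excursionTerm e F m (blockPath (x l) b) (n - l) =
      ENNReal.ofReal (tailWeight e m (blockPath (x l) b (n - l))) := by
    refine if_pos fun i hi => ?_
    rw [hstate (i + 1) (by omega)]
    exact notMem_of_lastVisit_lt (n := n) (by omega) (by omega)
  rw [← hlast, ← hterm]
  rfl

open Classical in
lemma visitIndex_le (n : ℕ) (x : ℕ → S) : visitIndex n x ≤ n :=
  (Finset.card_filter_le _ _).trans (by simp)

/-- Group the steps by excursion: distinct steps of one excursion have distinct ages, so they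
contribute at most its full weight. Fewer than `n` visits precede the start of any of these
excursions; counting all `k < n` for every `f` also includes blocks not yet used, which is harmless
because the bound is later divided by `n`. -/
lemma sum_tailWeight_le {F : Finset S} (hs₀ : s₀ ∈ F) (e : S → ℕ) (m n : ℕ)
    (z : S × ℕ → ℕ × S → ℝ × S) :
    ∑ i ∈ Finset.range n, ENNReal.ofReal (tailWeight e m (blockDriven (F : Set S) s₀ z i)) ≤
      ∑ f ∈ F, ∑ k ∈ Finset.range n, excursionSum e F m (blockPath f (z (f, k))) := by
  classical
  set x : ℕ → S := fun i => (blockDriven (F : Set S) s₀ z i).2 with hx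
  set θ : (S × ℕ) × ℕ → ℝ≥0∞ := fun c => excursionTerm e F m (blockPath c.1.1 (z c.1)) c.2
  set φ : ℕ → (S × ℕ) × ℕ := fun i => excursionIndex F i x
  have hmaps : ∀ i ∈ Finset.range n, (φ i).1 ∈ F ×ˢ Finset.range n := by
    intro i hi
    refine Finset.mem_product.2 ⟨lastVisit_mem (F := (F : Set S)) (x := x) hs₀ i, ?_⟩
    have h1 := visitIndex_le (lastVisit (F : Set S) i x) x
    have h2 := lastVisit_le (F : Set S) i x
    exact Finset.mem_range.2 ((h1.trans h2).trans_lt (Finset.mem_range.1 hi))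
  calc ∑ i ∈ Finset.range n, ENNReal.ofReal (tailWeight e m (blockDriven (F : Set S) s₀ z i))
      = ∑ i ∈ Finset.range n, θ (φ i) :=
        Finset.sum_congr rfl fun i _ => excursionTerm_blockPath (F := (F : Set S)) hs₀ e m i z
    _ = ∑ b ∈ F ×ˢ Finset.range n, ∑ i ∈ Finset.range n with (φ i).1 = b, θ (φ i) :=
        (Finset.sum_fiberwise_of_maps_to hmaps _).symm
    _ ≤ ∑ b ∈ F ×ˢ Finset.range n, excursionSum e F m (blockPath b.1 (z b)) := by
        refine Finset.sum_le_sum fun b _ => ?_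
        have hinj : Set.InjOn (fun i => (φ i).2)
            (Finset.filter (fun i => (φ i).1 = b) (Finset.range n)) := by
          intro i hi j hj hij
          simp only [Finset.coe_filter, Set.mem_ofPred_eq] at hi hj
          exact injective_excursionIndex F x (Prod.ext (hi.2.trans hj.2.symm) hij)
        rw [excursionSum]
        refine le_trans (le_of_eq ?_) (ENNReal.sum_le_tsum
          ((Finset.filter (fun i => (φ i).1 = b) (Finset.range n)).image fun i => (φ i).2))
        rw [Finset.sum_image hinj]
        refine Finset.sum_congr rfl fun i hi => ?_
        rw [← (Finset.mem_filter.1 hi).2]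
    _ = _ := Finset.sum_product _ _ _

/-- The steps that start outside large finite sets take a small fraction of time. -/
def Tight (e : S → ℕ) (y : ℕ → ℝ × S) : Prop :=
  ∀ j : ℕ, ∃ m N : ℕ, ∀ n ≥ N, ∑ i ∈ Finset.range n, tailWeight e m (y i) ≤ n / ((j : ℝ) + 1)

variable {A : Type*} [MeasurableSpace S] {M : SMDP S A} {π : S → A}

/-- Independent tables for all excursions. -/
def blockMeasure (M : SMDP S A) (π : S → A) : Measure (S × ℕ → ℕ × S → ℝ × S) :=
  Measure.infinitePi fun _ => stepMeasure M π ℕ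

instance : IsProbabilityMeasure (blockMeasure M π) := by
  unfold blockMeasure
  infer_instance

lemma blockMeasure_map_eval (b : S × ℕ) :
    (blockMeasure M π).map (fun z => z b) = stepMeasure M π ℕ :=
  Measure.infinitePi_map_eval _ b

lemma measurable_blockTable (q : ((S × ℕ) × ℕ) × S) : Measurable (blockTable q) :=
  (measurable_pi_apply (q.1.2, q.2)).comp (measurable_pi_apply q.1.1)

/-- Blocks are independent, and so are the entries within each block; uncurrying makes all entries
jointly independent. -/
lemma iIndepFun_blockTable : iIndepFun blockTable (blockMeasure M π) := by
  have := M.isProbabilityMeasure_law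
  have h := iIndepFun_uncurry_infinitePi' (ι := S × ℕ) (κ := ℕ × S)
    (X := fun _ _ (x : ℝ × S) => x) (fun _ q => M.law q.2 (π q.2)) fun _ _ => measurable_id
  exact h.precomp (g := fun q : ((S × ℕ) × ℕ) × S => (q.1.1, (q.1.2, q.2)))
    fun p q hpq => by
      simp only [Prod.mk.injEq] at hpq
      exact Prod.ext (Prod.ext hpq.1 hpq.2.1) hpq.2.2

variable [Countable S] [DiscreteMeasurableSpace S]

lemma isRun_blockDriven (M : SMDP S A) (π : S → A) (F : Set S) (s₀ : S) :
    M.IsRun π s₀ (blockMeasure M π)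
      (fun n z => drivenState (excursionIndex F) s₀ (fun q => blockTable q z) n)
      (fun n z => drivenSojourn (excursionIndex F) s₀ (fun q => blockTable q z) n) := by
  refine isRun_driven (Y := blockTable) (nonanticipating_excursionIndex F) (fun x _ => ?_)
    measurable_blockTable iIndepFun_blockTable fun j s => ?_
  · intro m n h
    exact injective_excursionIndex F x (Prod.ext_iff.1 h).1
  · rw [← stepMeasure_map_eval (M := M) (j.2, s), ← blockMeasure_map_eval j.1,
      Measure.map_map (measurable_pi_apply _) (measurable_pi_apply _)]
    rfl

lemma isRun_clock (M : SMDP S A) (π : S → A) (f : S) :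
    M.IsRun π f (stepMeasure M π ℕ) (fun n b => drivenState (fun n _ => n) f b n)
      (fun n b => drivenSojourn (fun n _ => n) f b n) :=
  isRun_driven (Y := fun q (z : ℕ × S → ℝ × S) => z q) nonanticipating_clock
    (fun _ _ _ _ h => (Prod.ext_iff.1 h).1) (fun _ => measurable_pi_apply _)
    (iIndepFun_stepMeasure ℕ) fun _ _ => stepMeasure_map_eval _

lemma measurable_blockPath (f : S) : Measurable (blockPath f) :=
  have hm : ∀ q : ℕ × S, Measurable fun z : ℕ × S → ℝ × S => z q := measurable_pi_apply
  measurable_pi_lambda _ fun n => (measurable_drivenSojourn nonanticipating_clock hm n).prodMk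
    (measurable_drivenState nonanticipating_clock hm n)

/-- All quantifiers range over natural numbers; this is why the small fraction is written `1 / (j +
1)`. -/
lemma measurableSet_tight (e : S → ℕ) : MeasurableSet {y : ℕ → ℝ × S | Tight e y} := by
  unfold Tight
  simp only [Set.ofPred_forall, Set.ofPred_exists]
  refine .iInter fun j => .iUnion fun m => .iUnion fun N => .iInter fun n => .iInter fun _ => ?_
  exact measurableSet_le (Finset.measurable_sum _ fun i _ =>
    (measurable_tailWeight e m).comp (measurable_pi_apply i)) measurable_const

/-- The strong law of large numbers for the excursions from `f`. -/
lemma ae_tendsto_excursionSum {C : ℝ} (hC : ∀ s, M.meanSojourn s (π s) ≤ C) (e : S → ℕ)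
    {F : Set S} {f : S} (hF : ∑' n, M.avoidProb π F n f < ∞) (m : ℕ) :
    ∀ᵐ z ∂blockMeasure M π, Tendsto
      (fun n : ℕ => (∑ k ∈ Finset.range n, (excursionSum e F m (blockPath f (z (f, k)))).toReal) / n)
      atTop (𝓝 (∫⁻ b, excursionSum e F m (blockPath f b) ∂stepMeasure M π ℕ).toReal) := by
  have hfin : ∫⁻ b, excursionSum e F m (blockPath f b) ∂stepMeasure M π ℕ < ∞ :=
    (lintegral_mono fun b => excursionSum_le e F m _).trans_lt
      ((isRun_clock M π f).lintegral_excursionSum_lt_top hC e hF)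
  have hmeas : Measurable fun b => excursionSum e F m (blockPath f b) :=
    (measurable_excursionSum e F m).comp (measurable_blockPath f)
  have hmean : ∫ b, (excursionSum e F m (blockPath f b)).toReal ∂stepMeasure M π ℕ =
      (∫⁻ b, excursionSum e F m (blockPath f b) ∂stepMeasure M π ℕ).toReal :=
    integral_toReal hmeas.aemeasurable (ae_lt_top hmeas hfin.ne)
  have hint : Integrable (fun b => (excursionSum e F m (blockPath f b)).toReal)
      (stepMeasure M π ℕ) := integrable_toReal_of_lintegral_ne_top hmeas.aemeasurable hfin.ne
  have hmap := fun k : ℕ => blockMeasure_map_eval (M := M) (π := π) (f, k)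
  have hindep : iIndepFun (fun (b : S × ℕ) (z : S × ℕ → ℕ × S → ℝ × S) => z b)
      (blockMeasure M π) :=
    iIndepFun_infinitePi (X := fun (_ : S × ℕ) (x : ℕ × S → ℝ × S) => x) fun _ => measurable_id
  have hident : ∀ k, IdentDistrib (fun z => (excursionSum e F m (blockPath f (z (f, k)))).toReal)
      (fun z => (excursionSum e F m (blockPath f (z (f, 0)))).toReal)
      (blockMeasure M π) (blockMeasure M π) := fun k =>
    IdentDistrib.comp (u := fun b => (excursionSum e F m (blockPath f b)).toReal)
      ⟨(measurable_pi_apply (f, k)).aemeasurable, (measurable_pi_apply (f, 0)).aemeasurable,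
        (hmap k).trans (hmap 0).symm⟩ hmeas.ennreal_toReal
  have h := strong_law_ae_real (μ := blockMeasure M π)
    (fun k z => (excursionSum e F m (blockPath f (z (f, k)))).toReal)
    (by
      rw [← hmap 0] at hint
      exact hint.comp_measurable (measurable_pi_apply _))
    (fun k l hkl => (hindep.indepFun (i := (f, k)) (j := (f, l)) (by simpa using hkl)).comp
      hmeas.ennreal_toReal hmeas.ennreal_toReal)
    hident
  convert! h using 5
  rw [← hmean, ← hmap 0, integral_map (measurable_pi_apply _).aemeasurable
    hmeas.ennreal_toReal.aestronglyMeasurable]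

/-- By the strong law, the average tail weight is asymptotically at most the sum over `F` of the
expected tail weights of excursions, and this sum tends to zero as `m` grows. -/
lemma ae_tight_blockDriven {C : ℝ} (hC : ∀ s, M.meanSojourn s (π s) ≤ C) (e : S → ℕ)
    {F : Finset S} (hs₀ : s₀ ∈ F) (hF : ∀ f ∈ F, ∑' n, M.avoidProb π F n f < ∞) :
    ∀ᵐ z ∂blockMeasure M π, Tight e (blockDriven (F : Set S) s₀ z) := by
  have h1 : ∀ᵐ z ∂blockMeasure M π, ∀ m : ℕ, ∀ f ∈ F, Tendsto
      (fun n : ℕ => (∑ k ∈ Finset.range n, (excursionSum e F m (blockPath f (z (f, k)))).toReal) / n)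
      atTop (𝓝 (∫⁻ b, excursionSum e F m (blockPath f b) ∂stepMeasure M π ℕ).toReal) := by
    refine ae_all_iff.2 fun m => ?_
    rw [Finset.eventually_all]
    exact fun f hf => ae_tendsto_excursionSum hC e (hF f hf) m
  have h2 : ∀ᵐ z ∂blockMeasure M π, ∀ f ∈ F, ∀ k : ℕ,
      excursionSum e F 0 (blockPath f (z (f, k))) < ∞ := by
    rw [Finset.eventually_all]
    refine fun f hf => ae_all_iff.2 fun k => ?_
    have hmeas : Measurable fun b => excursionSum e F 0 (blockPath f b) :=
      (measurable_excursionSum e F 0).comp (measurable_blockPath f)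
    have := ae_lt_top hmeas ((isRun_clock M π f).lintegral_excursionSum_lt_top hC e (hF f hf)).ne
    rw [← blockMeasure_map_eval (f, k)] at this
    exact ae_of_ae_map (measurable_pi_apply _).aemeasurable this
  have h3 : Tendsto (fun m => ∑ f ∈ F,
      (∫⁻ b, excursionSum e F m (blockPath f b) ∂stepMeasure M π ℕ).toReal) atTop (𝓝 0) := by
    rw [← Finset.sum_const_zero (s := F)]
    refine tendsto_finsetSum _ fun f hf => ?_
    rw [← ENNReal.toReal_zero]
    exact (ENNReal.tendsto_toReal ENNReal.zero_ne_top).comp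
      ((isRun_clock M π f).tendsto_lintegral_excursionSum hC e (hF f hf))
  filter_upwards [h1, h2] with z hz1 hz2 j
  obtain ⟨m, hm⟩ := (h3.eventually_lt_const (u := 1 / ((j : ℝ) + 1)) (by positivity)).exists
  have h4 := tendsto_finsetSum F fun f hf => hz1 m f hf
  obtain ⟨N, hN⟩ := eventually_atTop.1 ((h4.eventually_lt_const hm).and (eventually_gt_atTop 0))
  refine ⟨m, N, fun n hn => ?_⟩
  obtain ⟨h5, h6⟩ := hN n hn
  have hn0 : (0 : ℝ) < n := by exact_mod_cast h6
  rw [← Finset.sum_div, div_lt_iff₀ hn0, one_div_mul_eq_div] at h5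
  refine le_trans ?_ h5.le
  have hfin : ∀ f ∈ F, ∀ k, excursionSum e F m (blockPath f (z (f, k))) ≠ ∞ := fun f hf k =>
    ((excursionSum_le e F m _).trans_lt (hz2 f hf k)).ne
  have h7 := sum_tailWeight_le hs₀ e m n z
  rw [← ENNReal.ofReal_sum_of_nonneg fun i _ => tailWeight_nonneg e m _] at h7
  have h8 := ENNReal.toReal_mono (ENNReal.sum_ne_top.2 fun f hf =>
    ENNReal.sum_ne_top.2 fun k _ => hfin f hf k) h7
  rw [ENNReal.toReal_ofReal (Finset.sum_nonneg fun i _ => tailWeight_nonneg e m _),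
    ENNReal.toReal_sum fun f hf => ENNReal.sum_ne_top.2 fun k _ => hfin f hf k] at h8
  refine h8.trans (le_of_eq (Finset.sum_congr rfl fun f hf => ?_))
  exact ENNReal.toReal_sum fun k _ => hfin f hf k

lemma IsRun.ae_tight {Ω : Type*} [MeasurableSpace Ω] {P : Measure Ω} [IsProbabilityMeasure P]
    {X : ℕ → Ω → S} {T : ℕ → Ω → ℝ} (h : M.IsRun π s₀ P X T) {C : ℝ}
    (hC : ∀ s, M.meanSojourn s (π s) ≤ C) (hret : M.ReturnsToFiniteSet π) (e : S → ℕ) :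
    ∀ᵐ z ∂P, Tight e (path X T z) := by
  classical
  obtain ⟨F, hFfin, hF⟩ := hret
  -- With the initial state included, every time belongs to an excursion.
  set F' : Finset S := insert s₀ hFfin.toFinset with hF'
  have hsub : F ⊆ (F' : Set S) := by simp [hF']
  refine (isRun_blockDriven M π (F' : Set S) s₀).ae_path_of_ae_path h (measurableSet_tight e)
    (ae_tight_blockDriven hC e (by simp [hF']) fun f _ => ?_)
  exact (ENNReal.tsum_le_tsum fun n => avoidProb_anti M π hsub n f).trans_lt (hF f)

end Tightness

/-! ### Uniqueness of the equilibrium distribution -/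

section Equilibrium

variable {S A : Type*} [MeasurableSpace S]

lemma trans_nonneg (M : SMDP S A) (s : S) (a : A) (s' : S) : 0 ≤ M.trans s a s' :=
  measureReal_nonneg

lemma trans_le_one (M : SMDP S A) (s : S) (a : A) (s' : S) : M.trans s a s' ≤ 1 := by
  have := M.isProbabilityMeasure_law s a
  exact measureReal_le_one

lemma meanSojourn_pos (M : SMDP S A) (s : S) (a : A) : 0 < M.meanSojourn s a := by
  have := M.isProbabilityMeasure_law s a
  have hpos := M.sojourn_pos s a
  rw [meanSojourn, integral_pos_iff_support_of_nonneg_ae (hpos.mono fun x hx => hx.le)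
    (M.sojourn_integrable s a)]
  have : Function.support (fun x : ℝ × S => x.1) =ᵐ[M.law s a] Set.univ :=
    eventuallyEq_univ.2 (hpos.mono fun x hx => ne_of_gt hx)
  rw [measure_congr this, measure_univ]
  exact zero_lt_one

variable {M : SMDP S A} {π : S → A}

/-- Both have total mass one, so neither can lie below the other everywhere unless they coincide. -/
lemma IsEquilibrium.exists_lt {ω ω' : S → ℝ} (h : M.IsEquilibrium π ω)
    (h' : M.IsEquilibrium π ω') (hne : ω ≠ ω') : ∃ s, ω' s < ω s := by
  by_contra! hle
  refine hne (funext fun s => ?_)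
  have hsum : HasSum (fun s => ω' s - ω s) 0 := by simpa using h'.2.1.sub h.2.1
  have := (hasSum_zero_iff_of_nonneg fun s => sub_nonneg.2 (hle s)).1 hsum
  have := congrFun this s
  simp only [Pi.zero_apply] at this
  linarith

variable [Countable S] [DiscreteMeasurableSpace S]

lemma tsum_ofReal_trans (M : SMDP S A) (s : S) (a : A) :
    ∑' s', ENNReal.ofReal (M.trans s a s') = 1 := by
  have := M.isProbabilityMeasure_law s a
  have h := tsum_measure_preimage_singleton (μ := M.law s a) (f := Prod.snd)
    (Set.countable_univ (α := S)) fun s' _ => measurable_snd (measurableSet_singleton s')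
  rw [Set.preimage_univ, measure_univ, tsum_univ fun s' => M.law s a (Prod.snd ⁻¹' {s'})] at h
  rw [← h]
  exact tsum_congr fun s' => ofReal_trans M s a s'

/-- Where one equilibrium distribution exceeds another the chain cannot leave. -/
lemma IsEquilibrium.trans_eq_zero {ω ω' : S → ℝ} (h : M.IsEquilibrium π ω)
    (h' : M.IsEquilibrium π ω') {s s' : S} (hs : ω' s < ω s) (hs' : ω s' ≤ ω' s') :
    M.trans s (π s) s' = 0 := by
  -- `D` is the positive part of `ω - ω'` and `E` its image under one step of the chain. Then `D ≤
  -- E`, while both have the same finite mass, so they agree. As `D s' = 0`, no mass of `D` can flow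
  -- into `s'`.
  set D : S → ℝ≥0∞ := fun s => ENNReal.ofReal (ω s - ω' s) with hD
  set E : S → ℝ≥0∞ := fun s => ∑' s₀, D s₀ * ENNReal.ofReal (M.trans s₀ (π s₀) s) with hE
  have hmax : Summable fun s => max (ω s - ω' s) 0 := by
    refine h.2.1.summable.of_nonneg_of_le (fun _ => le_max_right _ _) fun s => max_le ?_ (h.1 s)
    linarith [h'.1 s]
  have hDmax : ∀ s, D s = ENNReal.ofReal (max (ω s - ω' s) 0) := fun s => by
    rw [hD]
    rcases le_total (ω s - ω' s) 0 with h0 | h0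
    · simp [ENNReal.ofReal_of_nonpos h0, max_eq_right h0]
    · simp [max_eq_left h0]
  have hDE : D ≤ E := by
    intro s
    have hsum : Summable fun s₀ => max (ω s₀ - ω' s₀) 0 * M.trans s₀ (π s₀) s :=
      hmax.of_nonneg_of_le (fun s₀ => mul_nonneg (le_max_right _ _) (trans_nonneg M _ _ _))
        fun s₀ => mul_le_of_le_one_right (le_max_right _ _) (trans_le_one M _ _ _)
    have hle : ω s - ω' s ≤ ∑' s₀, max (ω s₀ - ω' s₀) 0 * M.trans s₀ (π s₀) s := by
      refine hasSum_le (fun s₀ => ?_) ((h.2.2 s).sub (h'.2.2 s)) hsum.hasSum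
      rw [← sub_mul]
      exact mul_le_mul_of_nonneg_right (le_max_left _ _) (trans_nonneg M _ _ _)
    calc D s ≤ ENNReal.ofReal (∑' s₀, max (ω s₀ - ω' s₀) 0 * M.trans s₀ (π s₀) s) :=
          ENNReal.ofReal_le_ofReal hle
      _ = E s := by
          rw [ENNReal.ofReal_tsum_of_nonneg
            (fun s₀ => mul_nonneg (le_max_right _ _) (trans_nonneg M _ _ _)) hsum]
          refine tsum_congr fun s₀ => ?_
          rw [ENNReal.ofReal_mul (le_max_right _ _), hDmax]
  have hsumE : ∑' s, E s = ∑' s, D s := by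
    rw [ENNReal.tsum_comm]
    refine tsum_congr fun s₀ => ?_
    rw [ENNReal.tsum_mul_left, tsum_ofReal_trans, mul_one]
  have hfin : ∑' s, D s ≠ ∞ := by
    simp_rw [hDmax]
    rw [← ENNReal.ofReal_tsum_of_nonneg (fun _ => le_max_right _ _) hmax]
    exact ENNReal.ofReal_ne_top
  have hzero : ∑' s, (E s - D s) = 0 := by
    rw [← ENNReal.add_left_inj hfin, ← ENNReal.tsum_add, zero_add, ← hsumE]
    exact tsum_congr fun s => tsub_add_cancel_of_le (hDE s)
  have hE0 : E s' = 0 := by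
    have h1 := ENNReal.tsum_eq_zero.1 hzero s'
    rwa [show D s' = 0 from ENNReal.ofReal_of_nonpos (by linarith), tsub_zero] at h1
  have h2 := ENNReal.tsum_eq_zero.1 hE0 s
  rcases mul_eq_zero.1 h2 with h3 | h3
  · exact absurd (ENNReal.ofReal_eq_zero.1 h3) (by linarith)
  · exact le_antisymm (ENNReal.ofReal_eq_zero.1 h3) (trans_nonneg M _ _ _)

lemma IsEquilibrium.unique {ω ω' : S → ℝ} (hcl : M.NoDisjointClosedSets π)
    (h : M.IsEquilibrium π ω) (h' : M.IsEquilibrium π ω') : ω = ω' := by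
  by_contra hne
  refine hcl {s | ω' s < ω s} {s | ω s < ω' s}
    ⟨h.exists_lt h' hne, fun s hs s' hs' => h.trans_eq_zero h' hs (not_lt.1 hs')⟩
    ⟨h'.exists_lt h (Ne.symm hne), fun s hs s' hs' => h'.trans_eq_zero h hs (not_lt.1 hs')⟩ ?_
  rw [Set.disjoint_left]
  exact fun s (hs : ω' s < ω s) (hs' : ω s < ω' s) => lt_asymm hs hs'

end Equilibrium

/-! ### Limits along one trajectory -/

section Trajectory

variable {S : Type*} {e : S → ℕ} {y : ℕ → ℝ × S} {l : Filter ℕ}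

open Classical in
lemma sum_eq_sum_add (L : Finset S) (y : ℕ → ℝ × S) (a : ℕ → ℝ) (n : ℕ) :
    ∑ i ∈ Finset.range n, a i = (∑ s ∈ L, ∑ i ∈ Finset.range n, if (y i).2 = s then a i else 0) +
      ∑ i ∈ Finset.range n, if (y i).2 ∈ L then 0 else a i := by
  rw [Finset.sum_comm, ← Finset.sum_add_distrib]
  refine Finset.sum_congr rfl fun i _ => ?_
  rw [Finset.sum_ite_eq]
  split_ifs <;> simp

-- The finitely many states numbered below `m` capture all but a fraction `ε` of any average
-- dominated by the tail weights, uniformly in large `n`.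
open Classical in
lemma Tight.exists_finset (hy : Tight e y) (he : Function.Injective e) {a : ℕ → ℝ} {C : ℝ}
    (ha : ∀ i, |a i| ≤ C * (1 + |(y i).1|)) {ε : ℝ} (hε : 0 < ε) :
    ∃ L : Finset S, ∀ L', L ⊆ L' → ∀ᶠ n : ℕ in atTop, |(∑ i ∈ Finset.range n, a i) / n -
      ∑ s ∈ L', (∑ i ∈ Finset.range n, if (y i).2 = s then a i else 0) / n| ≤ ε := by
  have hC : 0 ≤ C := by
    have h1 := (abs_nonneg _).trans (ha 0)
    exact nonneg_of_mul_nonneg_left h1 (by positivity)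
  -- Makes `C / (j + 1) ≤ ε`.
  obtain ⟨j, hj⟩ := exists_nat_gt (C / ε)
  obtain ⟨m, N, hN⟩ := hy j
  have hfin : {s | e s < m}.Finite := (Set.finite_lt_nat m).preimage he.injOn
  refine ⟨hfin.toFinset, fun L' hL' => ?_⟩
  filter_upwards [eventually_ge_atTop N, eventually_gt_atTop 0] with n hn hn0
  have hn0' : (0 : ℝ) < n := by exact_mod_cast hn0
  rw [sum_eq_sum_add L' y a n, add_div, ← Finset.sum_div, add_sub_cancel_left, abs_div,
    Nat.abs_cast, div_le_iff₀ hn0']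
  calc |∑ i ∈ Finset.range n, if (y i).2 ∈ L' then 0 else a i|
      ≤ ∑ i ∈ Finset.range n, |if (y i).2 ∈ L' then 0 else a i| := Finset.abs_sum_le_sum_abs _ _
    _ ≤ ∑ i ∈ Finset.range n, C * tailWeight e m (y i) := by
        refine Finset.sum_le_sum fun i _ => ?_
        split_ifs with hi
        · rw [abs_zero]
          exact mul_nonneg hC (tailWeight_nonneg e m _)
        · have : m ≤ e (y i).2 := by
            by_contra! hlt
            exact hi (hL' (hfin.mem_toFinset.2 hlt))
          rw [tailWeight, if_pos this]
          exact ha i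
    _ ≤ C * (n / ((j : ℝ) + 1)) := by
        rw [← Finset.mul_sum]
        exact mul_le_mul_of_nonneg_left (hN n hn) hC
    _ ≤ ε * n := by
        rw [div_lt_iff₀ hε] at hj
        rw [← mul_div_assoc, div_le_iff₀ (by positivity)]
        nlinarith

-- Tightness lets the sum over states and the limit be interchanged. Here the limits are known along
-- a filter `l` and summability is a conclusion, as cluster points require;
-- `Tight.tendsto_of_hasSum` is the converse.
open Classical in
lemma Tight.hasSum_of_tendsto [l.NeBot] (hl : l ≤ atTop) (hy : Tight e y)
    (he : Function.Injective e) {a : ℕ → ℝ} {C : ℝ} (ha : ∀ i, |a i| ≤ C * (1 + |(y i).1|))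
    {b : S → ℝ} (hb : ∀ s, Tendsto (fun n : ℕ => (∑ i ∈ Finset.range n,
      if (y i).2 = s then a i else 0) / n) l (𝓝 (b s))) {c : ℝ}
    (hc : Tendsto (fun n : ℕ => (∑ i ∈ Finset.range n, a i) / n) l (𝓝 c)) : HasSum b c := by
  rw [HasSum, SummationFilter.unconditional_filter, Metric.tendsto_atTop]
  intro ε hε
  obtain ⟨L, hL⟩ := hy.exists_finset he ha (half_pos hε)
  refine ⟨L, fun L' hL' => ?_⟩
  have h1 := le_of_tendsto (hc.sub (tendsto_finsetSum L' fun s _ => hb s)).abs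
    ((hL L' hL').filter_mono hl)
  rw [dist_comm, Real.dist_eq]
  linarith

open Classical in
lemma Tight.tendsto_of_hasSum (hy : Tight e y) (he : Function.Injective e) {a : ℕ → ℝ} {C : ℝ}
    (ha : ∀ i, |a i| ≤ C * (1 + |(y i).1|)) {b : S → ℝ}
    (hb : ∀ s, Tendsto (fun n : ℕ => (∑ i ∈ Finset.range n,
      if (y i).2 = s then a i else 0) / n) atTop (𝓝 (b s))) {c : ℝ} (hc : HasSum b c) :
    Tendsto (fun n : ℕ => (∑ i ∈ Finset.range n, a i) / n) atTop (𝓝 c) := by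
  rw [Metric.tendsto_nhds]
  intro ε hε
  have hε3 : 0 < ε / 3 := by positivity
  obtain ⟨L, hL⟩ := hy.exists_finset he ha hε3
  rw [HasSum, SummationFilter.unconditional_filter, Metric.tendsto_atTop] at hc
  obtain ⟨L₁, hL₁⟩ := hc _ hε3
  have h1 := hL₁ (L ∪ L₁) Finset.subset_union_right
  have h2 := Metric.tendsto_nhds.1 (tendsto_finsetSum (L ∪ L₁) fun s _ => hb s) _ hε3
  filter_upwards [hL (L ∪ L₁) Finset.subset_union_left, h2] with n h3 h4
  rw [Real.dist_eq] at h1 h4 ⊢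
  rw [abs_lt] at h1 h4 ⊢
  rw [abs_le] at h3
  constructor <;> linarith [h1.1, h1.2, h3.1, h3.2, h4.1, h4.2]

open Classical in
/-- The fraction of the first `n` steps that start in `s`. -/
def frequency (y : ℕ → ℝ × S) (n : ℕ) (s : S) : ℝ :=
  (∑ i ∈ Finset.range n, if (y i).2 = s then 1 else 0) / n

lemma frequency_mem_Icc (y : ℕ → ℝ × S) (n : ℕ) (s : S) : frequency y n s ∈ Set.Icc 0 1 := by
  classical
  unfold frequency
  constructor
  · exact div_nonneg (Finset.sum_nonneg fun i _ => by split_ifs <;> norm_num) n.cast_nonneg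
  · refine div_le_one_of_le₀ ?_ n.cast_nonneg
    refine (Finset.sum_le_sum (g := fun _ => (1 : ℝ)) fun i _ => ?_).trans (by simp)
    split_ifs <;> norm_num

-- The shift only changes the count by its two boundary terms.
open Classical in
lemma tendsto_frequency_shift (hl : l ≤ atTop) {s : S} {q : ℝ}
    (hq : Tendsto (fun n => frequency y n s) l (𝓝 q)) :
    Tendsto (fun n : ℕ => (∑ i ∈ Finset.range n, if (y (i + 1)).2 = s then (1 : ℝ) else 0) / n) l
      (𝓝 q) := by
  have hd : Tendsto (fun n : ℕ => ((if (y n).2 = s then (1 : ℝ) else 0) -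
      if (y 0).2 = s then 1 else 0) / n) l (𝓝 0) := by
    refine Tendsto.mono_left ?_ hl
    refine squeeze_zero_norm (fun n => ?_) (tendsto_const_div_atTop_nhds_zero_nat 1)
    rw [norm_div, Real.norm_natCast]
    gcongr
    split_ifs <;> norm_num
  rw [← add_zero q]
  refine (hq.add hd).congr fun n => ?_
  rw [frequency, ← add_div]
  congr 1
  have h1 := Finset.sum_range_succ (fun i => if (y i).2 = s then (1 : ℝ) else 0) n
  have h2 := Finset.sum_range_succ' (fun i => if (y i).2 = s then (1 : ℝ) else 0) n
  linarith

variable {A : Type*} [MeasurableSpace S] {M : SMDP S A} {π : S → A}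

open Classical in
lemma Balanced.tendsto (hl : l ≤ atTop) {s : S} {g : ℝ × S → ℝ} (h : Balanced M π s g y) {q : ℝ}
    (hq : Tendsto (fun n => frequency y n s) l (𝓝 q)) :
    Tendsto (fun n : ℕ => (∑ i ∈ Finset.range n, if (y i).2 = s then
      g ((y i).1, (y (i + 1)).2) else 0) / n) l (𝓝 (q * ∫ x, g x ∂M.law s (π s))) := by
  rw [← zero_add (q * _)]
  refine ((Tendsto.mono_left h hl).add (hq.mul_const _)).congr fun n => ?_
  rw [frequency, div_mul_eq_mul_div, ← add_div, Finset.sum_mul, ← Finset.sum_add_distrib]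
  congr 1
  refine Finset.sum_congr rfl fun i _ => ?_
  split_ifs <;> ring

/-- A trajectory with the almost sure asymptotic properties of runs. -/
structure Regular (M : SMDP S A) (π : S → A) (e : S → ℕ) (y : ℕ → ℝ × S) : Prop where
  tight : Tight e y
  balanced_trans : ∀ s s', Balanced M π s ({x : ℝ × S | x.2 = s'}.indicator 1) y
  balanced_sojourn : ∀ s, Balanced M π s Prod.fst y
  sojourn_pos : ∀ n, 0 < (y n).1

variable [Countable S] [DiscreteMeasurableSpace S]

lemma integral_indicator_snd (s : S) (a : A) (s' : S) :
    ∫ x, {x : ℝ × S | x.2 = s'}.indicator (1 : ℝ × S → ℝ) x ∂M.law s a = M.trans s a s' :=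
  integral_indicator_one (measurable_snd (measurableSet_singleton s'))

/-- Arrivals in `s` are counted in two ways: their frequency is that of visits to `s` up to a shift,
and, split by the state of departure, it tends to the terms `q s₀ * p`. Tightness prevents mass from
escaping, in this sum and in the total mass. -/
lemma Regular.isEquilibrium [l.NeBot] (hl : l ≤ atTop) (he : Function.Injective e)
    (h : Regular M π e y) {q : S → ℝ} (hq : ∀ s, Tendsto (fun n => frequency y n s) l (𝓝 (q s))) :
    M.IsEquilibrium π q := by
  classical
  refine ⟨fun s => ge_of_tendsto' (hq s) fun n => (frequency_mem_Icc y n s).1, ?_, fun s => ?_⟩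
  · refine h.tight.hasSum_of_tendsto hl he (a := fun _ => 1) (C := 1) (fun i => ?_) hq ?_
    · simp
    · refine Tendsto.mono_left (tendsto_const_nhds.congr' ?_) hl
      filter_upwards [eventually_gt_atTop 0] with n hn
      have : (n : ℝ) ≠ 0 := by exact_mod_cast hn.ne'
      simp [this]
  · refine h.tight.hasSum_of_tendsto hl he
      (a := fun i => if (y (i + 1)).2 = s then 1 else 0) (C := 1) (fun i => ?_) (fun s₀ => ?_)
      (tendsto_frequency_shift hl (hq s))
    · have := abs_nonneg (y i).1
      split_ifs <;> simp; linarith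
    · have := (h.balanced_trans s₀ s).tendsto hl (hq s₀)
      rw [integral_indicator_snd] at this
      refine this.congr fun n => ?_
      simp [Set.indicator_apply]

/-- By Tychonoff the frequency vectors have a cluster point, reached along an ultrafilter. -/
lemma Regular.exists_isEquilibrium (he : Function.Injective e) (h : Regular M π e y) :
    ∃ q, M.IsEquilibrium π q := by
  have hK : IsCompact (Set.univ.pi fun _ : S => Set.Icc (0 : ℝ) 1) :=
    isCompact_univ_pi fun _ => isCompact_Icc
  obtain ⟨q, -, hq⟩ := hK.exists_mapClusterPt (u := frequency y) (f := atTop)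
    (tendsto_principal.2 (.of_forall fun n s _ => frequency_mem_Icc y n s))
  obtain ⟨U, hU, hUq⟩ := mapClusterPt_iff_ultrafilter.1 hq
  exact ⟨q, h.isEquilibrium hU he fun s => tendsto_pi_nhds.1 hUq s⟩

/-- In a compact space a sequence with a single possible cluster point converges. -/
lemma Regular.tendsto_frequency (he : Function.Injective e) (h : Regular M π e y)
    (hcl : M.NoDisjointClosedSets π) {ω : S → ℝ} (hω : M.IsEquilibrium π ω) (s : S) :
    Tendsto (fun n => frequency y n s) atTop (𝓝 (ω s)) := by
  have hK : IsCompact (Set.univ.pi fun _ : S => Set.Icc (0 : ℝ) 1) :=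
    isCompact_univ_pi fun _ => isCompact_Icc
  refine tendsto_pi_nhds.1 (hK.tendsto_nhds_of_unique_mapClusterPt
    (.of_forall fun n s _ => frequency_mem_Icc y n s) fun q _ hq => ?_) s
  obtain ⟨U, hU, hUq⟩ := mapClusterPt_iff_ultrafilter.1 hq
  exact (h.isEquilibrium hU he fun s => tendsto_pi_nhds.1 hUq s).unique hcl hω

/-- Long-run averages of functionals `k + c * (sojourn time)` along a regular trajectory. -/
lemma Regular.tendsto_average (he : Function.Injective e) (h : Regular M π e y)
    (hcl : M.NoDisjointClosedSets π) {ω : S → ℝ} (hω : M.IsEquilibrium π ω) {k c : S → ℝ} {C : ℝ}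
    (hk : ∀ s, |k s| ≤ C) (hc : ∀ s, |c s| ≤ C) (hτ : ∀ s, M.meanSojourn s (π s) ≤ C) :
    Summable (fun s => (k s + c s * M.meanSojourn s (π s)) * ω s) ∧
    Tendsto (fun n : ℕ => (∑ i ∈ Finset.range n, (k (y i).2 + c (y i).2 * (y i).1)) / n) atTop
      (𝓝 (∑' s, (k s + c s * M.meanSojourn s (π s)) * ω s)) := by
  classical
  have hsum : Summable fun s => (k s + c s * M.meanSojourn s (π s)) * ω s := by
    refine (hω.2.1.summable.mul_left (C + C * C)).of_norm_bounded fun s => ?_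
    rw [norm_mul, Real.norm_of_nonneg (hω.1 s), Real.norm_eq_abs]
    refine mul_le_mul_of_nonneg_right ((abs_add_le _ _).trans (add_le_add (hk s) ?_)) (hω.1 s)
    rw [abs_mul, abs_of_pos (meanSojourn_pos M s (π s))]
    exact mul_le_mul (hc s) (hτ s) (meanSojourn_pos M s (π s)).le ((abs_nonneg _).trans (hc s))
  refine ⟨hsum, h.tight.tendsto_of_hasSum he (C := C) (fun i => ?_) (fun s => ?_) hsum.hasSum⟩
  · refine (abs_add_le _ _).trans ?_
    rw [abs_mul, mul_add, mul_one]
    exact add_le_add (hk _) (mul_le_mul_of_nonneg_right (hc _) (abs_nonneg _))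
  · have h1 := h.tendsto_frequency he hcl hω s
    have h2 := (h1.mul_const (k s)).add
      (((h.balanced_sojourn s).tendsto le_rfl h1).const_mul (c s))
    have h3 : ω s * k s + c s * (ω s * ∫ x, x.1 ∂M.law s (π s)) =
        (k s + c s * M.meanSojourn s (π s)) * ω s := by rw [meanSojourn]; ring
    rw [h3] at h2
    refine h2.congr fun n => ?_
    rw [frequency, div_mul_eq_mul_div, mul_div_assoc', ← add_div, Finset.sum_mul, Finset.mul_sum,
      ← Finset.sum_add_distrib]
    congr 1
    refine Finset.sum_congr rfl fun i _ => ?_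
    split_ifs with hi
    · rw [hi]; ring
    · ring

lemma IsRun.ae_regular {Ω : Type*} [MeasurableSpace Ω] {P : Measure Ω} [IsProbabilityMeasure P]
    {X : ℕ → Ω → S} {T : ℕ → Ω → ℝ} {s₀ : S} (h : M.IsRun π s₀ P X T) {C : ℝ}
    (hC : ∀ s, M.meanSojourn s (π s) ≤ C) (hret : M.ReturnsToFiniteSet π) (e : S → ℕ) :
    ∀ᵐ z ∂P, Regular M π e (path X T z) := by
  have := M.isProbabilityMeasure_law
  have hm : ∀ s' : S, MeasurableSet {x : ℝ × S | x.2 = s'} := fun s' =>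
    measurable_snd (measurableSet_singleton s')
  have h1 : ∀ᵐ z ∂P, ∀ s s', Balanced M π s ({x : ℝ × S | x.2 = s'}.indicator 1) (path X T z) :=
    ae_all_iff.2 fun s => ae_all_iff.2 fun s' => h.ae_balanced s (measurable_one.indicator (hm s'))
      ((integrable_const 1).indicator (hm s'))
  have h2 : ∀ᵐ z ∂P, ∀ s, Balanced M π s Prod.fst (path X T z) :=
    ae_all_iff.2 fun s => h.ae_balanced s measurable_fst (M.sojourn_integrable s (π s))
  filter_upwards [h.ae_tight hC hret e, h1, h2, h.ae_sojourn_pos] with z hz1 hz2 hz3 hz4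
  exact ⟨hz1, hz2, hz3, hz4⟩

end Trajectory

/-! ### From averages over epochs to averages over time -/

section TimeAverage

/-- `d n` is the difference of two consecutive partial sums, whose quotients by `n` have the same
limit. -/
lemma tendsto_div_of_tendsto_sum_div {d : ℕ → ℝ} {a : ℝ}
    (h : Tendsto (fun n : ℕ => (∑ i ∈ Finset.range n, d i) / n) atTop (𝓝 a)) :
    Tendsto (fun n : ℕ => d n / n) atTop (𝓝 0) := by
  have h1 : Tendsto (fun n : ℕ => (∑ i ∈ Finset.range (n + 1), d i) / ((n + 1 : ℕ) : ℝ) *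
      (((n + 1 : ℕ) : ℝ) / n)) atTop (𝓝 (a * 1)) := by
    refine (h.comp (tendsto_add_atTop_nat 1)).mul ?_
    have h2 := (tendsto_const_div_atTop_nhds_zero_nat (1 : ℝ)).const_add 1
    rw [add_zero] at h2
    refine h2.congr' ?_
    filter_upwards [eventually_gt_atTop 0] with n hn
    have : (n : ℝ) ≠ 0 := by exact_mod_cast hn.ne'
    push_cast
    field_simp
  have h3 := h1.sub h
  rw [mul_one, sub_self] at h3
  refine h3.congr' ?_
  filter_upwards [eventually_gt_atTop 0] with n hn
  have : (n : ℝ) ≠ 0 := by exact_mod_cast hn.ne'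
  have : ((n + 1 : ℕ) : ℝ) ≠ 0 := by positivity
  rw [Finset.sum_range_succ]
  field_simp
  ring

variable {S A : Type*} [MeasurableSpace S] {M : SMDP S A} {π : S → A}

lemma totalReward_eq {x : ℕ → S} {d : ℕ → ℝ} (hd : ∀ n, 0 < d n) {t : ℝ} {j : ℕ}
    (h1 : ∑ i ∈ Finset.range j, d i ≤ t) (h2 : t < ∑ i ∈ Finset.range (j + 1), d i) :
    M.totalReward π x d t =
      ∑ i ∈ Finset.range j, (M.lump (x i) (π (x i)) + M.rate (x i) (π (x i)) * d i) +
      (M.lump (x j) (π (x j)) + M.rate (x j) (π (x j)) * (t - ∑ i ∈ Finset.range j, d i)) := by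
  have hmono : Monotone fun n => ∑ i ∈ Finset.range n, d i :=
    monotone_nat_of_le_succ fun n => by
      rw [Finset.sum_range_succ]
      linarith [hd n]
  rw [totalReward, tsum_eq_sum (s := Finset.range (j + 1)), Finset.sum_range_succ]
  · congr 1
    · refine Finset.sum_congr rfl fun i hi => ?_
      have h3 := hmono (Nat.succ_le_of_lt (Finset.mem_range.1 hi))
      simp only [Nat.succ_eq_add_one, Finset.sum_range_succ] at h3
      have h4 := hd i
      rw [if_pos (by linarith), min_eq_left (by linarith)]
    · rw [Finset.sum_range_succ] at h2
      rw [if_pos h1, min_eq_right (by linarith)]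
  · intro n hn
    have h3 : j + 1 ≤ n := by simpa using hn
    have h4 := hmono h3
    simp only at h4
    exact if_neg (by linarith)

/-- If `j t` steps are complete at time `t`, then `t / j t` tends to `τ` and the reward divided by
`j t` tends to `ρ`; the unfinished step costs at most `C + C * d (j t)`, which is negligible. -/
lemma tendsto_totalReward_div {x : ℕ → S} {d : ℕ → ℝ} (hd : ∀ n, 0 < d n) {C : ℝ}
    (hk : ∀ s, |M.lump s (π s)| ≤ C) (hc : ∀ s, |M.rate s (π s)| ≤ C) {τ ρ : ℝ} (hτ0 : 0 < τ)
    (hτ : Tendsto (fun n : ℕ => (∑ i ∈ Finset.range n, d i) / n) atTop (𝓝 τ))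
    (hρ : Tendsto (fun n : ℕ => (∑ i ∈ Finset.range n, (M.lump (x i) (π (x i)) +
      M.rate (x i) (π (x i)) * d i)) / n) atTop (𝓝 ρ)) :
    Tendsto (fun t => M.totalReward π x d t / t) atTop (𝓝 (ρ / τ)) := by
  set D : ℕ → ℝ := fun n => ∑ i ∈ Finset.range n, d i with hD
  have hmono : Monotone D := monotone_nat_of_le_succ fun n => by
    simp only [hD, Finset.sum_range_succ]
    linarith [hd n]
  have hDtop : Tendsto D atTop atTop := by
    refine (hτ.pos_mul_atTop hτ0 tendsto_natCast_atTop_atTop).congr' ?_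
    filter_upwards [eventually_gt_atTop 0] with n hn
    have : (n : ℝ) ≠ 0 := by exact_mod_cast hn.ne'
    exact div_mul_cancel₀ _ this
  -- The condition `0 ≤ t` sits inside the existential so that `choose` yields a function on all of
  -- `ℝ`.
  have hex : ∀ t : ℝ, ∃ n, 0 ≤ t → D n ≤ t ∧ t < D (n + 1) := by
    intro t
    have hn : ∃ n, t < D n := (hDtop.eventually_gt_atTop t).exists
    classical
    rcases hn' : Nat.find hn with _ | n
    · refine ⟨0, fun ht => ?_⟩
      have := Nat.find_spec hn
      rw [hn'] at this
      simp [hD] at this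
      linarith
    · refine ⟨n, fun _ => ⟨not_lt.1 (Nat.find_min hn (by omega)), ?_⟩⟩
      rw [← hn']
      exact Nat.find_spec hn
  choose j hj using hex
  have hjtop : Tendsto j atTop atTop := by
    refine tendsto_atTop.2 fun N => ?_
    filter_upwards [eventually_ge_atTop (D N), eventually_ge_atTop 0] with t ht ht0
    by_contra! hlt
    have := hmono (Nat.succ_le_of_lt hlt)
    have := (hj t ht0).2
    simp only [Nat.succ_eq_add_one] at *
    linarith
  have hpos : ∀ᶠ t in atTop, (0 : ℝ) < j t :=
    (hjtop.eventually_gt_atTop 0).mono fun t ht => by exact_mod_cast ht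
  have hd0 := (tendsto_div_of_tendsto_sum_div hτ).comp hjtop
  have ht : Tendsto (fun t => t / (j t : ℝ)) atTop (𝓝 τ) := by
    have hup := (hτ.comp hjtop).add hd0
    rw [add_zero] at hup
    refine tendsto_of_tendsto_of_tendsto_of_le_of_le' (hτ.comp hjtop) hup ?_ ?_
    · filter_upwards [hpos, eventually_ge_atTop 0] with t h0 ht0
      exact div_le_div_of_nonneg_right (hj t ht0).1 h0.le
    · filter_upwards [hpos, eventually_ge_atTop 0] with t h0 ht0
      simp only [Function.comp]
      rw [← add_div]
      refine div_le_div_of_nonneg_right ?_ h0.le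
      have := (hj t ht0).2
      simp only [hD, Finset.sum_range_succ] at this
      exact this.le
  have hrest : Tendsto (fun t => (M.lump (x (j t)) (π (x (j t))) +
      M.rate (x (j t)) (π (x (j t))) * (t - D (j t))) / (j t : ℝ)) atTop (𝓝 0) := by
    have h1 : Tendsto (fun n : ℕ => C / n + C * (d n / n)) atTop (𝓝 0) := by
      have := (tendsto_const_div_atTop_nhds_zero_nat C).add
        ((tendsto_div_of_tendsto_sum_div hτ).const_mul C)
      simpa using this
    refine squeeze_zero_norm' ?_ (h1.comp hjtop)
    filter_upwards [hpos, eventually_ge_atTop 0] with t h0 ht0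
    obtain ⟨h2, h3⟩ := hj t ht0
    simp only [hD, Finset.sum_range_succ] at h2 h3
    simp only [Function.comp]
    rw [norm_div, Real.norm_of_nonneg h0.le, mul_div_assoc', ← add_div]
    refine div_le_div_of_nonneg_right ?_ h0.le
    refine (abs_add_le _ _).trans (add_le_add (hk _) ?_)
    rw [abs_mul]
    refine mul_le_mul (hc _) ?_ (abs_nonneg _) ((abs_nonneg _).trans (hc (x 0)))
    rw [abs_of_nonneg (by simp only [hD]; linarith)]
    simp only [hD]
    linarith
  have hR := (hρ.comp hjtop).add hrest
  rw [add_zero] at hR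
  refine (hR.div ht hτ0.ne').congr' ?_
  filter_upwards [hpos, eventually_ge_atTop 0] with t h0 ht0
  simp only [Function.comp, Pi.div_apply]
  rw [totalReward_eq hd (hj t ht0).1 (hj t ht0).2, ← add_div, div_div_div_cancel_right₀ h0.ne']

/-- The long-run average reward of a stationary policy on countably many states, under uniform
bounds on the rewards and the mean sojourn times. -/
theorem exists_isEquilibrium_hasLongRunAverageReward {S : Type u} {A : Type v} [Countable S]
    [Nonempty S] [MeasurableSpace S] [DiscreteMeasurableSpace S] (M : SMDP S A) (π : S → A) {C : ℝ}
    (hk : ∀ s, |M.lump s (π s)| ≤ C) (hc : ∀ s, |M.rate s (π s)| ≤ C)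
    (hτ : ∀ s, M.meanSojourn s (π s) ≤ C) (hcl : M.NoDisjointClosedSets π)
    (hret : M.ReturnsToFiniteSet π) :
    ∃ ω : S → ℝ, M.IsEquilibrium π ω ∧ (∀ ω', M.IsEquilibrium π ω' → ω' = ω) ∧
      Summable (fun s => M.meanReward s (π s) * ω s) ∧
      Summable (fun s => M.meanSojourn s (π s) * ω s) ∧
      0 < ∑' s, M.meanSojourn s (π s) * ω s ∧
      SMDP.HasLongRunAverageReward.{u, v, w} M π
        ((∑' s, M.meanReward s (π s) * ω s) / ∑' s, M.meanSojourn s (π s) * ω s) := by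
  obtain ⟨e, he⟩ := exists_injective_nat S
  obtain ⟨s₀⟩ := ‹Nonempty S›
  -- One regular trajectory of the canonical run is enough for the existence of an equilibrium
  -- distribution.
  obtain ⟨z, hz⟩ := ((isRun_visitIndex M π s₀).ae_regular hτ hret e).exists
  obtain ⟨ω, hω⟩ := hz.exists_isEquilibrium he
  -- At least `1`, so that it also bounds the constant rate `1` that turns the average reward into
  -- the average sojourn time.
  set C' := max C 1
  have hk' : ∀ s, |M.lump s (π s)| ≤ C' := fun s => (hk s).trans (le_max_left _ _)
  have hc' : ∀ s, |M.rate s (π s)| ≤ C' := fun s => (hc s).trans (le_max_left _ _)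
  have hτ' : ∀ s, M.meanSojourn s (π s) ≤ C' := fun s => (hτ s).trans (le_max_left _ _)
  have hreward : ∀ {y}, Regular M π e y → _ := fun h =>
    h.tendsto_average he hcl hω hk' hc' hτ'
  have hsojourn : ∀ {y}, Regular M π e y → _ := fun h =>
    h.tendsto_average he hcl hω (k := fun _ => 0) (c := fun _ => 1) (C := C')
      (by simp [C']) (by simp [C']) hτ'
  simp only [zero_add, one_mul] at hsojourn
  have hpos : 0 < ∑' s, M.meanSojourn s (π s) * ω s := by
    obtain ⟨s, hs⟩ : ∃ s, ω s ≠ 0 := by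
      by_contra! h0
      have := hω.2.1
      rw [show ω = fun _ => 0 from funext h0] at this
      exact zero_ne_one (hasSum_zero.unique this)
    exact (hsojourn hz).1.tsum_pos
      (fun s => mul_nonneg (meanSojourn_pos M s (π s)).le (hω.1 s)) s
      (mul_pos (meanSojourn_pos M s (π s)) ((hω.1 s).lt_of_ne' hs))
  refine ⟨ω, hω, fun ω' hω' => hω'.unique hcl hω, (hreward hz).1, (hsojourn hz).1, hpos, ?_⟩
  intro s₁ Ω _ P _ X T hrun
  filter_upwards [hrun.ae_regular hτ hret e] with z hz
  exact tendsto_totalReward_div hz.sojourn_pos hk hc hpos (hsojourn hz).2 (hreward hz).2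

end TimeAverage

end SMDP

/-! ### Mean values and uniform bounds for the sliced network -/

namespace SlicedNetwork

variable {K : ℕ} (N : SlicedNetwork K)

instance : DiscreteMeasurableSpace N.State := ⟨fun _ => trivial⟩

instance : Nonempty N.State := ⟨⟨0, fun X => by simp⟩⟩

lemma integral_id_expMeasure {r : ℝ} (hr : 0 < r) : ∫ x, x ∂expMeasure r = 1 / r := by
  have hm : Measurable (gammaPDF 1 r) := (measurable_gammaPDFReal 1 r).ennreal_ofReal
  rw [expMeasure, gammaMeasure, integral_withDensity_eq_integral_toReal_smul hm (by simp [gammaPDF]),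
    ← setIntegral_eq_integral_of_forall_compl_eq_zero (s := Set.Ioi 0) fun x hx => ?_]
  · have h : ∀ x ∈ Set.Ioi (0 : ℝ), (gammaPDF 1 r x).toReal • x =
        r * (x ^ ((2 : ℝ) - 1) * Real.exp (-(r * x))) := by
      intro x hx
      have hx' : 0 ≤ x := le_of_lt hx
      rw [gammaPDF_of_nonneg hx', ENNReal.toReal_ofReal (by positivity)]
      norm_num
      ring
    rw [setIntegral_congr_fun measurableSet_Ioi h, integral_const_mul,
      Real.integral_rpow_mul_exp_neg_mul_Ioi two_pos hr, Real.Gamma_two]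
    norm_num
    field_simp
  · rcases (not_lt.1 hx : x ≤ 0).eq_or_lt with rfl | hx
    · simp
    · simp [gammaPDF_of_neg hx]

lemma meanSojourn_smdp (p : N.State → N.Action → PMF N.State) (s : N.State) (a : N.Action) :
    (N.smdp p).meanSojourn s a = N.tau s a := by
  have hr : 0 < 1 / N.tau s a := by simpa [tau] using N.eventRate_pos s a
  have := isProbabilityMeasure_expMeasure hr
  have h : (N.smdp p).meanSojourn s a =
      ∫ x : ℝ × N.State, x.1 ∂(expMeasure (1 / N.tau s a)).prod (p s a).toMeasure := rfl
  rw [h, integral_fun_fst (fun x : ℝ => x), integral_id_expMeasure hr]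
  simp

lemma meanReward_smdp (p : N.State → N.Action → PMF N.State) (s : N.State) (a : N.Action) :
    (N.smdp p).meanReward s a = N.reward s a := by
  rw [SMDP.meanReward, meanSojourn_smdp]
  exact zero_add _

lemma sum_arrivalRate_pos : 0 < ∑ k, N.arrivalRate k :=
  Finset.sum_pos (fun k _ => N.arrivalRate_pos k) ⟨⟨0, N.slices_pos⟩, Finset.mem_univ _⟩

/-- Arrivals alone trigger events at a fixed positive rate, which bounds the mean sojourn times
uniformly over the infinite state space. -/
lemma sum_arrivalRate_le_eventRate (s : N.State) (a : N.Action) :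
    ∑ k, N.arrivalRate k ≤ N.eventRate s a := by
  have h := N.serviceRate_pos
  unfold eventRate
  split_ifs
  · refine Finset.sum_le_sum fun k _ => ?_
    have := h k
    have h1 : 0 ≤ (s.1.2 k : ℝ) * N.serviceRate k := by positivity
    have h2 : 0 ≤ ((a k : ℕ) : ℝ) * N.serviceRate k := by positivity
    linarith
  · refine Finset.sum_le_sum fun k _ => ?_
    have := h k
    have h1 : 0 ≤ (s.1.2 k : ℝ) * N.serviceRate k := by positivity
    linarith

lemma tau_le (s : N.State) (a : N.Action) : N.tau s a ≤ 1 / ∑ k, N.arrivalRate k :=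
  one_div_le_one_div_of_le N.sum_arrivalRate_pos (N.sum_arrivalRate_le_eventRate s a)

lemma abs_revenueRate_le (s : N.State) (a : N.Action) : |N.revenueRate s a| ≤
    (∑ k, (N.maxAdmit : ℝ) * ∑ X, N.usage k X * N.price X) + N.penalty := by
  have hX : ∀ k, 0 ≤ ∑ X, N.usage k X * N.price X := fun k =>
    Finset.sum_nonneg fun X _ => mul_nonneg (N.usage_nonneg k X) (N.price_nonneg X)
  have hsum : 0 ≤ ∑ k, (N.maxAdmit : ℝ) * ∑ X, N.usage k X * N.price X :=
    Finset.sum_nonneg fun k _ => mul_nonneg (Nat.cast_nonneg _) (hX k)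
  have hp := N.penalty_nonneg
  unfold revenueRate
  split_ifs
  · rw [abs_of_nonneg (Finset.sum_nonneg fun k _ => mul_nonneg (Nat.cast_nonneg _) (hX k))]
    refine le_add_of_le_of_nonneg (Finset.sum_le_sum fun k _ => ?_) hp
    exact mul_le_mul_of_nonneg_right (by exact_mod_cast Nat.lt_succ_iff.1 (a k).2) (hX k)
  · rw [abs_neg, abs_of_nonneg hp]
    linarith

end SlicedNetwork

end

theorem theorem1 :
    -- arbitrary semi-Markov decision processes with finitely many states
    (∀ (S : Type u) (A : Type v) [Finite S] [Nonempty S] [MeasurableSpace S]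
        [DiscreteMeasurableSpace S] (M : SMDP S A) (π : S → A), M.NoDisjointClosedSets π →
      ∃ ω : S → ℝ, M.IsEquilibrium π ω ∧ (∀ ω', M.IsEquilibrium π ω' → ω' = ω) ∧
        0 < ∑' s, M.meanSojourn s (π s) * ω s ∧
        SMDP.HasLongRunAverageReward.{u, v, w} M π
          ((∑' s, M.meanReward s (π s) * ω s) / ∑' s, M.meanSojourn s (π s) * ω s)) ∧
    -- the sliced network, whose queues need not be bounded
    (∀ (K : ℕ) (N : SlicedNetwork K) (p : N.State → N.Action → PMF N.State)
        (π : N.State → N.Action), (N.smdp p).NoDisjointClosedSets π →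
        (N.smdp p).ReturnsToFiniteSet π →
      ∃ ω : N.State → ℝ, (N.smdp p).IsEquilibrium π ω ∧
        (∀ ω', (N.smdp p).IsEquilibrium π ω' → ω' = ω) ∧
        Summable (fun s => N.reward s (π s) * ω s) ∧
        Summable (fun s => N.tau s (π s) * ω s) ∧
        0 < ∑' s, N.tau s (π s) * ω s ∧
        SMDP.HasLongRunAverageReward.{0, 0, w} (N.smdp p) π
          ((∑' s, N.reward s (π s) * ω s) / ∑' s, N.tau s (π s) * ω s)) := by
  refine ⟨fun S A _ _ _ _ M π hcl => ?_, fun K N p π hcl hret => ?_⟩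
  · have hret : M.ReturnsToFiniteSet π := by
      -- Every step lands in the whole space, so only the term `n = 0` of the series survives.
      refine ⟨Set.univ, Set.finite_univ, fun s => ?_⟩
      have h : ∀ n, n ∉ ({0} : Finset ℕ) → M.avoidProb π Set.univ n s = 0 := by
        intro n hn
        obtain ⟨n, rfl⟩ := Nat.exists_eq_succ_of_ne_zero (by simpa using hn)
        have : IsEmpty ↥((Set.univ : Set S)ᶜ) := by simp
        exact tsum_empty
      rw [tsum_eq_sum h]
      simp [SMDP.avoidProb]
    obtain ⟨C₁, h₁⟩ := (Set.finite_range fun s => |M.lump s (π s)|).bddAbove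
    obtain ⟨C₂, h₂⟩ := (Set.finite_range fun s => |M.rate s (π s)|).bddAbove
    obtain ⟨C₃, h₃⟩ := (Set.finite_range fun s => M.meanSojourn s (π s)).bddAbove
    obtain ⟨ω, hω, huniq, -, -, hpos, hlim⟩ :=
      M.exists_isEquilibrium_hasLongRunAverageReward π (C := max C₁ (max C₂ C₃))
        (fun s => (h₁ ⟨s, rfl⟩).trans (by simp)) (fun s => (h₂ ⟨s, rfl⟩).trans (by simp))
        (fun s => (h₃ ⟨s, rfl⟩).trans (by simp)) hcl hret
    exact ⟨ω, hω, huniq, hpos, hlim⟩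
  · set C := max (1 / ∑ k, N.arrivalRate k)
      ((∑ k, (N.maxAdmit : ℝ) * ∑ X, N.usage k X * N.price X) + N.penalty) with hC
    have hC0 : 0 ≤ C := (one_div_pos.2 N.sum_arrivalRate_pos).le.trans (le_max_left _ _)
    have h := (N.smdp p).exists_isEquilibrium_hasLongRunAverageReward π (C := C)
      (fun s => by simpa [SlicedNetwork.smdp] using hC0)
      (fun s => (N.abs_revenueRate_le s (π s)).trans (le_max_right _ _))
      (fun s => by
        rw [N.meanSojourn_smdp]
        exact (N.tau_le s (π s)).trans (le_max_left _ _)) hcl hret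
    simpa only [N.meanSojourn_smdp, N.meanReward_smdp] using h
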